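/- Let $A$ be a bijective skew PBW extension of a subring $R$: there are $x_1,\dots,x_n\in A$ such that the monomials $x^\alpha=x_1^{\alpha_1}\cdots x_n^{\alpha_n}$ form a basis of $A$ as a left $R$-module; for every $i$ there is a bijection $\sigma_i:R\to R$ with $x_ir-\sigma_i(r)x_i\in R$ for all $r\in R$; and for all $i,j$ there is $c_{i,j}\in R\setminus\{0\}$ with $x_jx_i-c_{i,j}x_ix_j\in R+Rx_1+\cdots+Rx_n$, where $c_{i,j}$ is invertible in $R$ for $i<j$. Assume that $A$ satisfies the rank condition (if there is an epimorphism $A^p\to A^q$ of free modules then $p\ge q$). Fix a monomial order on the monomials $x^\alpha e_i$ of the free right module $A^r$: a total order with $x^\alpha e_i\le x^{\alpha+\gamma}e_i$, with $x^{\alpha+\gamma}e_i\le x^{\beta+\gamma}e_j$ whenever $x^\alpha e_i\le x^\beta e_j$, and with $x^\alpha e_i<x^\beta e_i$ whenever $|\alpha|<|\beta|$. Let $F\in M_{r\times s}(A)$, and let $\langle F\rangle_A\subseteq A^r$ be the right $A$-module generated by the columns of $F$. A non-zero vector $f$ with leading monomial $m$ is reduced modulo the columns $g_1,\dots,g_t$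 of a matrix $G$ by replacing it by $f-\sum_j g_jq_j$, where each $q_j$ is $0$ or a term $x^{\gamma_j}\rho_j$ ($\rho_j\in R$) for which the leading monomial of $g_j$, multiplied on the right by $x^{\gamma_j}$, has leading monomial $m$, and where $f$ and $\sum_j g_jq_j$ have the same coefficient at $m$. The columns of $G$ are a right Gröbner basis of a right submodule $N\subseteq A^r$ if they lie in $N$ and every non-zero element of $N$ can be reduced modulo them. Consider the following algorithm with input $F$. 1. If $s<r$, return $0$. 2. If $s\ge r$, compute a right Gröbner basis $G=[g_1\cdots g_t]$ of $\langle F\rangle_A$ together with a matrix $H\in M_{s\times t}(A)$ with $G=FH$ by the right Buchberger algorithm: start with $G:=F$, $H:=I_s$; for every least common multiple $m$ of leading monomials of columns of $G$, choose finitely many generators of the right $R$-module of tuples $q=(x^{\gamma_j}\rho_j)_j$ of terms as above for which the terms at $m$ cancel in $Gq$; reduce each S-vector $Gq$ modulo $G$ as long as possible; if some S-vector has a non-zero remainder $Gp$, adjoin the column $Gp$ to $G$ and the column $Hp$ to $H$ and start this step again; stop when all S-vectors reduce to $0$. 3. For $j=1,\dots,r$ divide the canonical vector $e_j$ by $G$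 on the right, i.e. reduce it modulo $G$ as long as possible. If some $e_j$ has a non-zero remainder, return $0$. Otherwise each division gives $e_j=g_1k_{1j}+\cdots+g_tk_{tj}$; put $K=[k_{ij}]\in M_{t\times r}(A)$, so that $I_r=GK$, and return $L:=HK$. Where a choice is possible (of reductions, of generators), any valid choice may be made. Then: (a) Whenever the algorithm stops, its answer is correct: it returns $0$ if and only if $F$ has no right inverse, and this is the case if and only if $s<r$ or $e_j\notin\langle F\rangle_A$ for some $j$; otherwise it returns a matrix $L=HK\in M_{s\times r}(A)$ with $FL=I_r$, where $G=FH$, $GK=I_r$ and the columns of $G$ are a right Gröbner basis of $\langle F\rangle_A$. (b) If $R$ is right Noetherian, then for all choices the algorithm stops after finitely many steps with an answer. (c) Whenever step 3 is reached, the columns of $G$ are a right Gröbner basis of $\langle F\rangle_A$, and $G=FH$. (d) If $s\ge r$, then, for an arbitrary right Gröbner basis $G$ of $\langle F\rangle_A$ and an arbitrary $H$ with $G=FH$, step 3 always stops after finitely many steps; it returns $0$ if and only if $F$ has no right inverse, equivalently if and only if some $e_j\notin\langle F\rangle_A$; otherwise it returns a matrix $L=HK$ with $GK=I_r$ and $FL=I_r$.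 -/

import Mathlib

open Matrix

namespace SkewPBW

/-- The standard monomial `x^α = x_1^{α_1} ⋯ x_n^{α_n}` (product in this order). -/
def mon {A : Type*} [Ring A] {n : ℕ} (x : Fin n → A) (α : Fin n → ℕ) : A :=
  (List.ofFn fun i => x i ^ α i).prod

/-- `A` is a skew PBW extension of its subring `R` in the variables `x_1, …, x_n`,
`A = σ(R)⟨x_1, …, x_n⟩`. -/
structure IsExtension {A : Type*} [Ring A] (R : Subring A) {n : ℕ} (x : Fin n → A) : Prop where
  /-- The standard monomials are a basis of `A` as a left `R`-module. -/
  linearIndependent : LinearIndependent R (mon x)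
  span_eq_top : Submodule.span R (Set.range (mon x)) = ⊤
  /-- `x_i r - c_{i,r} x_i ∈ R` with `c_{i,r} ≠ 0`, for every `r ≠ 0`. -/
  var_coeff : ∀ (i : Fin n) (r : R), r ≠ 0 → ∃ c : R, c ≠ 0 ∧ x i * r - c * x i ∈ R
  /-- `x_j x_i - c_{i,j} x_i x_j ∈ R + R x_1 + ⋯ + R x_n` with `c_{i,j} ≠ 0`. -/
  var_var : ∀ i j : Fin n, ∃ c : R, c ≠ 0 ∧
    x j * x i - c * (x i * x j) ∈ Submodule.span R (insert 1 (Set.range x))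

/-- The skew PBW extension is bijective: the maps `σ_i : r ↦ c_{i,r}` (with `σ_i 0 = 0`) are
bijections of `R` and the `c_{i,j}`, `i < j`, are units of `R`. Since the standard monomials are a
left basis, `σ_i` and `c_{i,j}` (`i < j`) are uniquely determined by the relations below. -/
structure IsBijectiveExtension {A : Type*} [Ring A] (R : Subring A) {n : ℕ} (x : Fin n → A) : Prop
    extends IsExtension R x where
  sigma_bijective : ∀ i : Fin n, ∃ σ : R → R, Function.Bijective σ ∧
    ∀ r : R, x i * r - σ r * x i ∈ R
  isUnit_c : ∀ i j : Fin n, i < j → ∃ c : R, IsUnit c ∧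
    x j * x i - c * (x i * x j) ∈ Submodule.span R (insert 1 (Set.range x))

/-- The basis of standard monomials. -/
noncomputable def IsExtension.basis {A : Type*} [Ring A] {R : Subring A} {n : ℕ} {x : Fin n → A}
    (h : IsExtension R x) : Module.Basis (Fin n → ℕ) R A :=
  Module.Basis.mk h.linearIndependent h.span_eq_top.ge

/-- A monomial `x^α e_i` of the free module `A^r`. -/
@[ext] structure ModMon (n r : ℕ) where
  exp : Fin n → ℕ
  idx : Fin r

/-- The given linear order is a monomial order on the monomials of `A^r`. In a bijective extension
`x^α x^γ` has leading monomial `x^(α + γ)`, so products of monomials are sums of exponents. Degree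
compatibility is required inside each component only, so that term-over-position and
position-over-term orders are both included. -/
structure IsMonomialOrder (n r : ℕ) [LinearOrder (ModMon n r)] : Prop where
  le_mul : ∀ (α γ : Fin n → ℕ) (i : Fin r), (⟨α, i⟩ : ModMon n r) ≤ ⟨α + γ, i⟩
  mul_le_mul : ∀ (α β γ : Fin n → ℕ) (i j : Fin r),
    (⟨α, i⟩ : ModMon n r) ≤ ⟨β, j⟩ → (⟨α + γ, i⟩ : ModMon n r) ≤ ⟨β + γ, j⟩
  degree_compatible : ∀ (α β : Fin n → ℕ) (i : Fin r),
    ∑ k, α k < ∑ k, β k → (⟨α, i⟩ : ModMon n r) < ⟨β, i⟩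

section Groebner

variable {A : Type*} [Ring A] {R : Subring A} {n : ℕ} {x : Fin n → A} (h : IsExtension R x)
  {r s t : ℕ}

/-- The coefficient of the vector `f ∈ A^r` at the monomial `x^α e_i`. -/
noncomputable def coeff (f : Fin r → A) (m : ModMon n r) : R := h.basis.repr (f m.idx) m.exp

/-- The right `A`-submodule of `A^r` generated by the columns of `F`. -/
def columnModule (F : Matrix (Fin r) (Fin s) A) : Submodule Aᵐᵒᵖ (Fin r → A) :=
  Submodule.span Aᵐᵒᵖ (Set.range F.col)

variable [LinearOrder (ModMon n r)]

/-- `m` is the leading monomial of `f` (so `f ≠ 0`). In a bijective extension it is the same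
whether coefficients are written on the left or on the right of the monomials. -/
def IsLeadingMonomial (f : Fin r → A) (m : ModMon n r) : Prop :=
  coeff h f m ≠ 0 ∧ ∀ m', m < m' → coeff h f m' = 0

/-- Every `q_j` is zero or a term `x^γ ρ` (`ρ ∈ R`) such that `lm(g_j) x^γ` has leading monomial
`m`, where `g_j` is the `j`-th column of `G`. -/
def IsTermVector (G : Matrix (Fin r) (Fin t) A) (m : ModMon n r) (q : Fin t → A) : Prop :=
  ∀ j, q j = 0 ∨ ∃ (β γ : Fin n → ℕ) (ρ : R), IsLeadingMonomial h (G.col j) ⟨β, m.idx⟩ ∧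
    β + γ = m.exp ∧ q j = mon x γ * ρ

/-- One step of right reduction modulo the columns `g_j` of `G` replaces `f` by
`f - ∑_j g_j q_j = f - G q`, where each non-zero `q_j` is a term `x^{γ_j} ρ_j` with
`lm(g_j) x^{γ_j}` having leading monomial `lm(f)`, and the leading term of `f` is cancelled. -/
def IsReduction (G : Matrix (Fin r) (Fin t) A) (f : Fin r → A) (q : Fin t → A) : Prop :=
  ∃ m, IsLeadingMonomial h f m ∧ IsTermVector h G m q ∧ coeff h (G *ᵥ q) m = coeff h f m

/-- `f` is reducible modulo the columns of `G`. -/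
def IsReducible (G : Matrix (Fin r) (Fin t) A) (f : Fin r → A) : Prop :=
  ∃ q, IsReduction h G f q

/-- The columns of `G` are a right Gröbner basis of the right submodule `N` of `A^r`: they lie in
`N` and every non-zero element of `N` is reducible. (Zero columns are allowed; they are never used
in a reduction.) -/
def IsRightGroebnerBasis (N : Submodule Aᵐᵒᵖ (Fin r → A)) (G : Matrix (Fin r) (Fin t) A) : Prop :=
  (∀ j, G.col j ∈ N) ∧ ∀ f ∈ N, f ≠ 0 → IsReducible h G f

/-- `m` is the least common multiple of the leading monomials of a non-empty set of columns of `G`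
(with leading monomials in the same component). -/
def IsLcm (G : Matrix (Fin r) (Fin t) A) (m : ModMon n r) : Prop :=
  ∃ (J : Finset (Fin t)) (β : Fin t → Fin n → ℕ), J.Nonempty ∧
    (∀ j ∈ J, IsLeadingMonomial h (G.col j) ⟨β j, m.idx⟩) ∧ m.exp = J.sup β

/-- `q = (x^{γ_j} ρ_j)_j` is a syzygy of the leading terms at `m`: the terms at `m` cancel in the
S-vector `∑_j g_j x^{γ_j} ρ_j = G q`. -/
def IsLeadingSyzygy (G : Matrix (Fin r) (Fin t) A) (m : ModMon n r) (q : Fin t → A) : Prop :=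
  IsTermVector h G m q ∧ coeff h (G *ᵥ q) m = 0

/-- The finite list `B` consists of syzygies of leading terms at least common multiples `m`, and for
each such `m` it contains generators of the right `R`-module of these syzygies. -/
def IsSyzygyList (G : Matrix (Fin r) (Fin t) A) (B : List (Fin t → A)) : Prop :=
  (∀ q ∈ B, ∃ m, IsLcm h G m ∧ IsLeadingSyzygy h G m q) ∧
  ∀ m, IsLcm h G m → ∀ q, IsLeadingSyzygy h G m q →
    q ∈ Submodule.span R.op {p | p ∈ B ∧ IsLeadingSyzygy h G m p}

end Groebner

/-- The matrix `G` with the additional last column `v`. -/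
def addColumn {A : Type*} {r t : ℕ} (G : Matrix (Fin r) (Fin t) A) (v : Fin r → A) :
    Matrix (Fin r) (Fin (t + 1)) A :=
  Matrix.of fun i => Fin.snoc (G i) (v i)

/-- The states of the algorithm for an `r × s` matrix. -/
inductive State (A : Type*) (r s : ℕ)
  /-- The beginning. -/
  | start
  /-- Buchberger's algorithm, head of the loop: current generators `G`, with `G = F H`. -/
  | basis (t : ℕ) (G : Matrix (Fin r) (Fin t) A) (H : Matrix (Fin s) (Fin t) A)
  /-- Buchberger's algorithm: the S-vectors `G q`, `q ∈ todo`, remain to be reduced. -/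
  | pending (t : ℕ) (G : Matrix (Fin r) (Fin t) A) (H : Matrix (Fin s) (Fin t) A)
      (todo : List (Fin t → A))
  /-- Buchberger's algorithm: the vector `G p` is being reduced. -/
  | reducing (t : ℕ) (G : Matrix (Fin r) (Fin t) A) (H : Matrix (Fin s) (Fin t) A)
      (todo : List (Fin t → A)) (p : Fin t → A)
  /-- Division of the canonical vector `e_j` by `G`, with partial quotient `p` and current
  remainder `e_j - G p`; the columns of `K` before column `j` have been found. (Columns are numbered
  from `0`.) -/
  | test (t : ℕ) (G : Matrix (Fin r) (Fin t) A) (H : Matrix (Fin s) (Fin t) A)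
      (K : Matrix (Fin t) (Fin r) A) (j : ℕ) (p : Fin t → A)
  /-- The algorithm has stopped; `none` stands for the answer `0`. -/
  | done (out : Option (Matrix (Fin s) (Fin r) A))

section Algorithm

variable {A : Type*} [Ring A] {R : Subring A} {n : ℕ} {x : Fin n → A} (h : IsExtension R x)
  {r s : ℕ} [LinearOrder (ModMon n r)]

/-- The steps of the algorithm with input `F`. Besides arithmetic in `A`, a step needs only to solve
(or to recognize as unsolvable) a right linear equation over `R`, or to find finitely many
generators of the right syzygies of finitely many elements of `R`; any valid answer is accepted. -/
inductive Step (F : Matrix (Fin r) (Fin s) A) : State A r s → State A r s → Prop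
  /-- If `s < r`, return `0`. -/
  | small : s < r → Step F .start (.done none)
  /-- If `s ≥ r`, compute a right Gröbner basis, starting from the columns of `F`. -/
  | init : r ≤ s → Step F .start (.basis s F 1)
  | syzygies {t G H B} : IsSyzygyList h G B →
      Step F (.basis t G H) (.pending t G H B)
  | next {t G H q todo} : Step F (.pending t G H (q :: todo)) (.reducing t G H todo q)
  | reduce {t G H todo p q} : IsReduction h G (G *ᵥ p) q →
      Step F (.reducing t G H todo p) (.reducing t G H todo (p - q))
  /-- The S-vector has been reduced to zero. -/
  | discard {t G H todo p} : G *ᵥ p = 0 →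
      Step F (.reducing t G H todo p) (.pending t G H todo)
  /-- The S-vector has a non-zero reduced remainder, which becomes a new generator. -/
  | enlarge {t G H todo p} : G *ᵥ p ≠ 0 → ¬ IsReducible h G (G *ᵥ p) →
      Step F (.reducing t G H todo p)
        (.basis (t + 1) (addColumn G (G *ᵥ p)) (addColumn H (H *ᵥ p)))
  /-- All S-vectors have been reduced to zero: start dividing the canonical vectors. -/
  | finish {t G H} : Step F (.pending t G H []) (.test t G H 0 0 0)
  | divide {t G H K j p q} (hj : j < r) :
      IsReduction h G (Pi.single (⟨j, hj⟩ : Fin r) 1 - G *ᵥ p) q →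
      Step F (.test t G H K j p) (.test t G H K j (p + q))
  /-- `e_j = G p` lies in the right module generated by `G`; record `p` as a column of `K`. -/
  | member {t G H K j p} (hj : j < r) :
      Pi.single (⟨j, hj⟩ : Fin r) 1 - G *ᵥ p = 0 →
      Step F (.test t G H K j p) (.test t G H (K.updateCol ⟨j, hj⟩ p) (j + 1) 0)
  /-- `e_j` has a non-zero reduced remainder: return `0`. -/
  | notMember {t G H K j p} (hj : j < r) :
      Pi.single (⟨j, hj⟩ : Fin r) 1 - G *ᵥ p ≠ 0 →
      ¬ IsReducible h G (Pi.single (⟨j, hj⟩ : Fin r) 1 - G *ᵥ p) →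
      Step F (.test t G H K j p) (.done none)
  /-- All `e_j` have been expressed through `G`: return `L = H K`. -/
  | output {t G H K p} : Step F (.test t G H K r p) (.done (some (H * K)))

/-- The state `c'` can be reached from the state `c`. -/
def Reaches (F : Matrix (Fin r) (Fin s) A) (c c' : State A r s) : Prop :=
  Relation.ReflTransGen (Step h F) c c'

/-- Every run from the state `c` is finite, gets stuck nowhere, and so stops in a state `done`. -/
def AlwaysHalts (F : Matrix (Fin r) (Fin s) A) (c : State A r s) : Prop :=
  Acc (fun b a => Step h F a b) c ∧
  ∀ c', Reaches h F c c' → (∃ c'', Step h F c' c'') ∨ ∃ out, c' = .done out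

end Algorithm

end SkewPBW

/-!
A bijective skew PBW extension is filtered by the degree of monomials, and up to terms of lower
degree a product `x^δ b x^γ` with `b ∈ R` equals `τ(b) c x^(δ + γ)`, where `τ` is an automorphism of
`R` and `c` is a unit of `R` (`IsBijectiveExtension.exists_mon_mul_mon`). As the monomial order
refines the degree inside each component of `A^r`, this gives the multiplicativity of leading
monomials (`SuppIn.mul`) and controls leading coefficients
(`IsBijectiveExtension.coeff_translate`). Since `R` may have zero divisors and leading coefficients
need not be invertible, everything is expressed by representations `G u` which are bounded by a
monomial (`IsQuot`).

Correctness rests on Buchberger's criterion (`isReducible_of_isSyzygyList`). In a representation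
`G u` of a vector bounded by `m`, either the terms at `m` do not cancel, and then they reduce the
vector, or they form a syzygy of leading terms. Such a syzygy is, up to smaller terms, a translate
of a combination of the chosen syzygies at a least common multiple. Their S-vectors have smaller
representations because they have been reduced to zero, so the vector has a representation with a
smaller bound.

Reduction terminates because the monomial order is a well-order, by Dickson's lemma. The enlargement
of `G` terminates because the right ideals of coefficients of bounded representations
(`leadIdeal`) are monotone in the monomial with respect to divisibility: multiplication by `x^δ`
changes the coefficients by automorphisms and units only. A new generator makes one of these ideals
larger (`leadIdeal_lt_addColumn`), and monotone families from a well-quasi-order to an order with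
the ascending chain condition satisfy this condition themselves
(`wellFounded_gt_monotone_of_wellQuasiOrdered`).

Finally `F` has a right inverse if and only if all `e_j` lie in its column module; the rank
condition excludes this when `s < r`, because a right inverse `L` of `F` induces an epimorphism
`v ↦ v L` from `A^s` to `A^r`.
-/

namespace SkewPBW

/-! ### The degree filtration -/

section Words

variable {A : Type*} [Ring A] {R : Subring A} {n : ℕ} {x : Fin n → A}

/-- The product `x_{i_1} ⋯ x_{i_k}` of the variables along a list of indices, in any order. -/
def word (x : Fin n → A) (w : List (Fin n)) : A := (w.map x).prod

/-- The sorted list of indices whose word is the standard monomial `x^α`. -/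
def sortedList (α : Fin n → ℕ) : List (Fin n) :=
  (List.finRange n).flatMap fun i => List.replicate (α i) i

lemma word_append (w w' : List (Fin n)) : word x (w ++ w') = word x w * word x w' := by
  simp [word]

lemma word_cons (i : Fin n) (w : List (Fin n)) : word x (i :: w) = x i * word x w := by
  simp [word]

lemma mon_eq_word (α : Fin n → ℕ) : mon x α = word x (sortedList α) := by
  unfold mon word sortedList
  rw [List.ofFn_eq_map]
  generalize List.finRange n = l
  induction l with
  | nil => simp
  | cons a l ih => simp [ih]

lemma count_sortedList (α : Fin n → ℕ) (i : Fin n) : (sortedList α).count i = α i := by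
  rw [sortedList, List.count_flatMap]
  have : (List.count i ∘ fun j => List.replicate (α j) j) =
      fun j => if i = j then α j else 0 := by
    funext j
    by_cases hij : i = j
    · simp [hij]
    · simp [List.count_replicate, hij, Ne.symm hij]
  rw [this, ← Fin.sum_univ_def, Finset.sum_ite_eq, if_pos (Finset.mem_univ i)]

lemma perm_sortedList (w : List (Fin n)) : w.Perm (sortedList fun i => w.count i) :=
  List.perm_iff_count.2 fun i => (count_sortedList (fun i => w.count i) i).symm

lemma sortedList_append_perm (α γ : Fin n → ℕ) :
    (sortedList α ++ sortedList γ).Perm (sortedList (α + γ)) :=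
  List.perm_iff_count.2 fun i => by simp [count_sortedList]

lemma length_sortedList (α : Fin n → ℕ) : (sortedList α).length = ∑ i, α i := by
  have h := Multiset.toFinset_sum_count_eq (sortedList α : Multiset (Fin n))
  simp only [Multiset.coe_count, count_sortedList, Multiset.coe_card] at h
  rw [← h]
  refine Finset.sum_subset (Finset.subset_univ _) fun i _ hi => ?_
  rw [← count_sortedList α i, List.count_eq_zero]
  simpa using hi

lemma mon_zero : mon x 0 = 1 := by simp [mon]

lemma mon_single (i : Fin n) : mon x (Pi.single i 1) = x i := by
  rw [mon_eq_word]
  have : ([i] : List (Fin n)).Perm (sortedList (Pi.single i 1)) :=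
    List.perm_iff_count.2 fun j => by
      rw [count_sortedList]
      by_cases hij : i = j
      · subst hij; simp
      · simp [hij, Ne.symm hij]
  rw [← List.singleton_perm.1 this]
  simp [word]

variable (R x) in
/-- The left `R`-submodule of `A` spanned by the words of length less than `d`: the elements of
degree less than `d`. -/
def degreeLT (d : ℕ) : Submodule R A := Submodule.span R {a | ∃ w, w.length < d ∧ word x w = a}

lemma word_mem_degreeLT {d : ℕ} {w : List (Fin n)} (hw : w.length < d) :
    word x w ∈ degreeLT R x d :=
  Submodule.subset_span ⟨w, hw, rfl⟩

lemma degreeLT_mono {d e : ℕ} (hde : d ≤ e) : degreeLT R x d ≤ degreeLT R x e :=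
  Submodule.span_mono fun _ ⟨w, hw, e⟩ => ⟨w, hw.trans_le hde, e⟩

lemma IsExtension.basis_apply (h : IsExtension R x) (α : Fin n → ℕ) : h.basis α = mon x α := by
  simp [IsExtension.basis]

lemma IsExtension.repr_mon (h : IsExtension R x) (α : Fin n → ℕ) :
    h.basis.repr (mon x α) = Finsupp.single α 1 := by
  rw [← h.basis_apply, Module.Basis.repr_self]

/-- The linear independence of `1` and `x_i`, which makes `σ_i` unique and hence a ring
homomorphism. -/
lemma IsExtension.eq_zero_of_mul_var_mem (h : IsExtension R x) {i : Fin n} {c : R}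
    (hc : (c : A) * x i ∈ R) : c = 0 := by
  have e : c • mon x (Pi.single i 1) = (⟨_, hc⟩ : R) • mon x 0 := by
    simp [mon_single, mon_zero, Subring.smul_def]
  have := DFunLike.congr_fun (congrArg h.basis.repr e) (Pi.single i 1)
  simpa [h.repr_mon] using this

/-- The bijections `σ_i` are ring automorphisms. -/
lemma IsBijectiveExtension.exists_sigma (hA : IsBijectiveExtension R x) :
    ∃ σ : Fin n → R ≃+* R, ∀ i (r : R), x i * r - σ i r * x i ∈ R := by
  have key : ∀ i, ∃ σ : R ≃+* R, ∀ r : R, x i * r - σ r * x i ∈ R := by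
    intro i
    obtain ⟨σ, hb, hσ⟩ := hA.sigma_bijective i
    have uniq : ∀ {r c : R}, x i * r - c * x i ∈ R → σ r = c := by
      intro r c hc
      have := R.sub_mem hc (hσ r)
      refine sub_eq_zero.1 (hA.eq_zero_of_mul_var_mem (i := i) ?_)
      convert this using 1
      push_cast
      noncomm_ring
    let φ : R →+* R :=
      { toFun := σ, map_one' := ?_, map_mul' := ?_, map_zero' := ?_, map_add' := ?_ }
    · exact ⟨RingEquiv.ofBijective φ hb, hσ⟩
    · exact uniq (by simp)
    · intro r s
      refine uniq ?_
      have := R.add_mem (R.mul_mem (hσ r) s.2) (R.mul_mem (σ r).2 (hσ s))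
      convert this using 1
      push_cast
      noncomm_ring
    · exact uniq (by simp)
    · intro r s
      refine uniq ?_
      convert R.add_mem (hσ r) (hσ s) using 1
      push_cast
      noncomm_ring
  choose σ hσ using key
  exact ⟨σ, hσ⟩

lemma IsBijectiveExtension.var_mul_mem_degreeLT (hA : IsBijectiveExtension R x) (i : Fin n)
    {d : ℕ} {a : A} (ha : a ∈ degreeLT R x d) : x i * a ∈ degreeLT R x (d + 1) := by
  obtain ⟨σ, hσ⟩ := hA.exists_sigma
  induction ha using Submodule.span_induction with
  | mem a ha =>
    obtain ⟨w, hw, rfl⟩ := ha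
    rw [← word_cons]
    exact word_mem_degreeLT (by simpa using hw)
  | zero => simp
  | add a b _ _ ha hb => rw [mul_add]; exact add_mem ha hb
  | smul r a hmem ha =>
    have e : x i * (r • a) = σ i r • (x i * a) + (⟨_, hσ i r⟩ : R) • a := by
      simp only [Subring.smul_def, smul_eq_mul]
      noncomm_ring
    rw [e]
    exact add_mem (Submodule.smul_mem _ _ ha)
      (Submodule.smul_mem _ _ (degreeLT_mono (Nat.le_succ d) hmem))

/-- Moving a coefficient from the right to the left of a word twists it by an automorphism of `R`,
up to terms of lower degree. -/
lemma IsBijectiveExtension.exists_word_mul_coeff (hA : IsBijectiveExtension R x)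
    (w : List (Fin n)) :
    ∃ τ : R ≃+* R, ∀ r : R, word x w * r - τ r * word x w ∈ degreeLT R x w.length := by
  obtain ⟨σ, hσ⟩ := hA.exists_sigma
  induction w with
  | nil => exact ⟨RingEquiv.refl R, fun r => by simp [word]⟩
  | cons i w ih =>
    obtain ⟨τ, hτ⟩ := ih
    refine ⟨τ.trans (σ i), fun r => ?_⟩
    have e : word x (i :: w) * r - (τ.trans (σ i)) r * word x (i :: w) =
        x i * (word x w * r - τ r * word x w) + (⟨_, hσ i (τ r)⟩ : R) • word x w := by
      simp only [Subring.smul_def, smul_eq_mul, word_cons, RingEquiv.coe_trans, Function.comp]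
      noncomm_ring
    rw [e]
    exact add_mem (hA.var_mul_mem_degreeLT i (hτ r))
      (Submodule.smul_mem _ _ (word_mem_degreeLT (by simp)))

/-- Permuting the letters of a word multiplies it by a unit of `R`, up to terms of lower degree. -/
lemma IsBijectiveExtension.exists_unit_of_perm (hA : IsBijectiveExtension R x)
    {w w' : List (Fin n)} (hw : w.Perm w') :
    ∃ c : Rˣ, word x w - (c : R) * word x w' ∈ degreeLT R x w.length := by
  obtain ⟨σ, hσ⟩ := hA.exists_sigma
  -- the lower terms of the commutation relations, times a word, have lower degree
  have low : ∀ (w : List (Fin n)) {b : A}, b ∈ Submodule.span R (insert 1 (Set.range x)) →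
      b * word x w ∈ degreeLT R x (w.length + 2) := by
    intro w b hb
    induction hb using Submodule.span_induction with
    | mem a ha =>
      rcases ha with rfl | ⟨i, rfl⟩
      · rw [one_mul]; exact word_mem_degreeLT (by simp)
      · rw [← word_cons]; exact word_mem_degreeLT (by simp)
    | zero => simp
    | add a b _ _ ha hb => rw [add_mul]; exact add_mem ha hb
    | smul r a hmem ha => rw [smul_mul_assoc]; exact Submodule.smul_mem _ _ ha
  induction hw with
  | nil => exact ⟨1, by simp⟩
  | @cons i l₁ l₂ hp ih =>
    obtain ⟨c, hc⟩ := ih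
    refine ⟨Units.map (σ i : R →* R) c, ?_⟩
    have e : word x (i :: l₁) - ((Units.map (σ i : R →* R) c : Rˣ) : R) * word x (i :: l₂) =
        x i * (word x l₁ - (c : R) * word x l₂) + (⟨_, hσ i c⟩ : R) • word x l₂ := by
      simp only [Subring.smul_def, smul_eq_mul, word_cons, Units.coe_map, MonoidHom.coe_coe]
      noncomm_ring
    rw [e]
    exact add_mem (hA.var_mul_mem_degreeLT i hc)
      (Submodule.smul_mem _ _ (word_mem_degreeLT (by simp [hp.length_eq])))
  | swap i j l =>
    have up : ∀ {i j : Fin n}, i < j → ∃ c : Rˣ,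
        word x (j :: i :: l) - (c : R) * word x (i :: j :: l) ∈ degreeLT R x (l.length + 2) := by
      intro i j hij
      obtain ⟨c, ⟨c, rfl⟩, hc⟩ := hA.isUnit_c i j hij
      refine ⟨c, ?_⟩
      have e : word x (j :: i :: l) - (c : R) * word x (i :: j :: l) =
          (x j * x i - (c : R) * (x i * x j)) * word x l := by
        simp only [word_cons]
        noncomm_ring
      rw [e]
      exact low l hc
    rcases lt_trichotomy i j with hij | rfl | hij
    · exact up hij
    · exact ⟨1, by simp⟩
    -- the relation between `x_i` and `x_j` is solved for the other product; here `c` must be a unit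
    · obtain ⟨c, hc⟩ := up hij
      refine ⟨c⁻¹, ?_⟩
      have hcc : (((c⁻¹ : Rˣ) : R) : A) * ((c : R) : A) = 1 := by
        rw [← Subring.coe_mul]; simp
      have e : word x (j :: i :: l) - ((c⁻¹ : Rˣ) : R) * word x (i :: j :: l) =
          -(((c⁻¹ : Rˣ) : R) • (word x (i :: j :: l) - (c : R) * word x (j :: i :: l))) := by
        simp only [Subring.smul_def, smul_eq_mul, mul_sub, ← mul_assoc, hcc]
        noncomm_ring
      rw [e]
      exact neg_mem (Submodule.smul_mem _ _ hc)
  | trans h₁ h₂ ih₁ ih₂ =>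
    obtain ⟨c, hc⟩ := ih₁
    obtain ⟨d, hd⟩ := ih₂
    refine ⟨c * d, ?_⟩
    rw [← h₁.length_eq] at hd
    convert add_mem hc (Submodule.smul_mem _ (c : R) hd) using 1
    simp only [Subring.smul_def, smul_eq_mul, Units.val_mul, Subring.coe_mul]
    noncomm_ring

/-- Words of length less than `d` are combinations of standard monomials of degree less than `d`:
sorting a word produces a unit times a standard monomial and a combination of shorter words. -/
lemma IsBijectiveExtension.degreeLT_le_span (hA : IsBijectiveExtension R x) (d : ℕ) :
    degreeLT R x d ≤ Submodule.span R (mon x '' {α | ∑ i, α i < d}) := by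
  induction d using Nat.strong_induction_on with
  | _ d ih =>
    refine Submodule.span_le.2 ?_
    rintro _ ⟨w, hw, rfl⟩
    obtain ⟨c, hc⟩ := hA.exists_unit_of_perm (perm_sortedList w)
    rw [← mon_eq_word] at hc
    have hlen : ∑ i, w.count i = w.length := by
      rw [← length_sortedList fun i => w.count i, (perm_sortedList w).length_eq]
    have hsub : {α : Fin n → ℕ | ∑ i, α i < w.length} ⊆ {α | ∑ i, α i < d} :=
      fun α hα => lt_trans hα hw
    have h1 := Submodule.span_mono (Set.image_mono hsub) (ih _ hw hc)
    have h2 : (c : R) • mon x (fun i => w.count i) ∈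
        Submodule.span R (mon x '' {α | ∑ i, α i < d}) :=
      Submodule.smul_mem _ _ (Submodule.subset_span ⟨_, hlen.trans_lt hw, rfl⟩)
    have := add_mem h1 h2
    simpa [Subring.smul_def] using this

end Words

/-! ### Leading terms of products of monomials -/

section Coefficients

variable {A : Type*} [Ring A] {R : Subring A} {n : ℕ} {x : Fin n → A}

lemma IsBijectiveExtension.repr_eq_zero_of_mem_degreeLT (hA : IsBijectiveExtension R x) {d : ℕ}
    {a : A} (ha : a ∈ degreeLT R x d) {η : Fin n → ℕ} (hη : d ≤ ∑ i, η i) :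
    hA.basis.repr a η = 0 := by
  have h1 := hA.degreeLT_le_span d ha
  rw [← funext hA.basis_apply, hA.basis.mem_span_image] at h1
  by_contra hne
  have : η ∈ {α : Fin n → ℕ | ∑ i, α i < d} := h1 (Finsupp.mem_support_iff.2 hne)
  exact absurd this (not_lt.2 hη)

/-- The product of two monomials with a coefficient in between: the leading coefficient is obtained
from the given one by an automorphism of `R` and multiplication by a unit. -/
lemma IsBijectiveExtension.exists_mon_mul_mon (hA : IsBijectiveExtension R x)
    (δ γ : Fin n → ℕ) : ∃ (τ : R ≃+* R) (c : Rˣ), ∀ b : R,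
      mon x δ * (b * mon x γ) - (τ b * (c : R) : R) • mon x (δ + γ) ∈
        degreeLT R x (∑ i, δ i + ∑ i, γ i) := by
  obtain ⟨τ, hτ⟩ := hA.exists_word_mul_coeff (sortedList δ)
  obtain ⟨c, hc⟩ := hA.exists_unit_of_perm (sortedList_append_perm δ γ)
  refine ⟨τ, c, fun b => ?_⟩
  have h1 : (mon x δ * b - τ b * mon x δ) * mon x γ ∈ degreeLT R x (∑ i, δ i + ∑ i, γ i) := by
    have : ∀ {d : ℕ} {a : A}, a ∈ degreeLT R x d →
        a * mon x γ ∈ degreeLT R x (d + ∑ i, γ i) := by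
      intro d a ha
      induction ha using Submodule.span_induction with
      | mem a ha =>
        obtain ⟨w, hw, rfl⟩ := ha
        rw [mon_eq_word, ← word_append]
        exact word_mem_degreeLT (by simpa [length_sortedList] using hw)
      | zero => simp
      | add a b _ _ ha hb => rw [add_mul]; exact add_mem ha hb
      | smul r a hmem ha => rw [smul_mul_assoc]; exact Submodule.smul_mem _ _ ha
    have h2 := hτ b
    rw [length_sortedList, ← mon_eq_word] at h2
    exact this h2
  rw [word_append, List.length_append, length_sortedList, length_sortedList, ← mon_eq_word,
    ← mon_eq_word, ← mon_eq_word] at hc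
  convert add_mem h1 (Submodule.smul_mem _ (τ b) hc) using 1
  simp only [Subring.smul_def, smul_eq_mul, Subring.coe_mul]
  noncomm_ring

end Coefficients

/-! ### Products -/

section Products

variable {A : Type*} [Ring A] {R : Subring A} {n : ℕ} {x : Fin n → A}

lemma IsBijectiveExtension.repr_mon_mul_mon (hA : IsBijectiveExtension R x)
    (δ γ : Fin n → ℕ) : ∃ (τ : R ≃+* R) (c : Rˣ), ∀ (b : R) (η : Fin n → ℕ),
      ∑ i, δ i + ∑ i, γ i ≤ ∑ i, η i →
      hA.basis.repr (mon x δ * (b * mon x γ)) η = if η = δ + γ then τ b * (c : R) else 0 := by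
  obtain ⟨τ, c, h⟩ := hA.exists_mon_mul_mon δ γ
  refine ⟨τ, c, fun b η hη => ?_⟩
  have := hA.repr_eq_zero_of_mem_degreeLT (h b) hη
  rw [map_sub, Finsupp.sub_apply, sub_eq_zero] at this
  rw [this, map_smul, hA.repr_mon, Finsupp.smul_apply, Finsupp.single_apply]
  simp [eq_comm]

lemma IsExtension.sum_repr_mul_mon (h : IsExtension R x) (a : A) :
    ∑ δ ∈ (h.basis.repr a).support, (h.basis.repr a δ : A) * mon x δ = a := by
  conv_rhs => rw [← h.basis.linearCombination_repr a]
  rw [Finsupp.linearCombination_apply, Finsupp.sum]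
  simp [h.basis_apply, Subring.smul_def]

lemma IsExtension.repr_mul_apply (h : IsExtension R x) (a b : A) (η : Fin n → ℕ) :
    h.basis.repr (a * b) η = ∑ δ ∈ (h.basis.repr a).support,
      h.basis.repr a δ * h.basis.repr (mon x δ * b) η := by
  conv_lhs => rw [← h.sum_repr_mul_mon a, Finset.sum_mul, map_sum, Finsupp.finsetSum_apply]
  refine Finset.sum_congr rfl fun δ _ => ?_
  rw [mul_assoc, ← smul_eq_mul (h.basis.repr a δ : A), ← Subring.smul_def, map_smul,
    Finsupp.smul_apply, smul_eq_mul]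

/-- Every monomial of a product is a product of monomials of the factors, or of lower degree than
such a product. -/
lemma IsBijectiveExtension.exists_of_repr_mul_ne_zero (hA : IsBijectiveExtension R x) {a b : A}
    {η : Fin n → ℕ} (hη : hA.basis.repr (a * b) η ≠ 0) :
    ∃ δ γ, hA.basis.repr a δ ≠ 0 ∧ hA.basis.repr b γ ≠ 0 ∧
      (η = δ + γ ∨ ∑ i, η i < ∑ i, δ i + ∑ i, γ i) := by
  by_contra! hne
  apply hη
  rw [hA.repr_mul_apply]
  refine Finset.sum_eq_zero fun δ hδ => ?_
  rw [← hA.sum_repr_mul_mon b, Finset.mul_sum, map_sum, Finsupp.finsetSum_apply]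
  refine mul_eq_zero_of_right _ (Finset.sum_eq_zero fun γ hγ => ?_)
  obtain ⟨h1, h2⟩ := hne δ γ (Finsupp.mem_support_iff.1 hδ) (Finsupp.mem_support_iff.1 hγ)
  obtain ⟨τ, c, h⟩ := hA.repr_mon_mul_mon δ γ
  rw [h _ _ h2, if_neg h1]

/-- The coefficient of `a (b x^γ)` at `x^(β + γ)`, if `a` has degree at most `|β|`. -/
lemma IsBijectiveExtension.repr_mul_top (hA : IsBijectiveExtension R x) (β γ : Fin n → ℕ) :
    ∃ (τ : R ≃+* R) (c : Rˣ), ∀ (a : A) (b : R),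
      (∀ δ, hA.basis.repr a δ ≠ 0 → ∑ i, δ i ≤ ∑ i, β i) →
      hA.basis.repr (a * (b * mon x γ)) (β + γ) = hA.basis.repr a β * (τ b * (c : R)) := by
  obtain ⟨τ, c, h⟩ := hA.repr_mon_mul_mon β γ
  refine ⟨τ, c, fun a b ha => ?_⟩
  have hsum : ∑ i, (β + γ) i = ∑ i, β i + ∑ i, γ i := by simp [Finset.sum_add_distrib]
  rw [hA.repr_mul_apply, Finset.sum_eq_single β, h b _ hsum.ge, if_pos rfl]
  · intro δ hδ hne
    obtain ⟨τ', c', h'⟩ := hA.repr_mon_mul_mon δ γ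
    rw [h' b _ (by rw [hsum]; exact Nat.add_le_add_right (ha δ (Finsupp.mem_support_iff.1 hδ)) _),
      if_neg (fun e => hne (add_right_cancel e).symm), mul_zero]
  · intro hβ
    rw [Finsupp.notMem_support_iff.1 hβ, zero_mul]

end Products

/-! ### Monomial orders -/

section Order

variable {n r : ℕ}

/-- The monomial `x^(α + δ) e_i` for `m = x^α e_i`. -/
def ModMon.translate (m : ModMon n r) (δ : Fin n → ℕ) : ModMon n r := ⟨m.exp + δ, m.idx⟩

/-- Divisibility of monomials of `A^r`. -/
def ModMon.Divides (m m' : ModMon n r) : Prop := m.exp ≤ m'.exp ∧ m.idx = m'.idx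

lemma ModMon.Divides.translate_sub {m m' : ModMon n r} (h : m.Divides m') :
    m.translate (m'.exp - m.exp) = m' :=
  ModMon.ext (add_tsub_cancel_of_le h.1) h.2

lemma ModMon.translate_zero (m : ModMon n r) : m.translate 0 = m := ModMon.ext (add_zero _) rfl

lemma ModMon.translate_add (m : ModMon n r) (γ δ : Fin n → ℕ) :
    m.translate (γ + δ) = (m.translate γ).translate δ := ModMon.ext (add_assoc _ _ _).symm rfl

lemma ModMon.translate_right_injective (m : ModMon n r) : Function.Injective m.translate :=
  fun _ _ e => add_left_cancel (congrArg ModMon.exp e)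

lemma ModMon.translate_left_injective (δ : Fin n → ℕ) :
    Function.Injective fun m : ModMon n r => m.translate δ :=
  fun _ _ e => ModMon.ext (add_right_cancel (congrArg ModMon.exp e)) (congrArg ModMon.idx e :)

instance : IsPreorder (ModMon n r) ModMon.Divides where
  refl _ := ⟨le_rfl, rfl⟩
  trans _ _ _ h h' := ⟨h.1.trans h'.1, h.2.trans h'.2⟩

/-- Dickson's lemma. -/
lemma ModMon.wellQuasiOrdered_divides : WellQuasiOrdered (ModMon.Divides (n := n) (r := r)) := by
  intro f
  have h1 : WellQuasiOrdered fun a b : Fin n → ℕ => a ≤ b := wellQuasiOrdered_le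
  have h2 : WellQuasiOrdered fun a b : Fin r => a = b := Finite.wellQuasiOrdered _
  exact (h1.prod h2) fun k => ((f k).exp, (f k).idx)

/-- Families of elements of an order with the ascending chain condition which are monotone for a
well-quasi-order satisfy the ascending chain condition. -/
lemma wellFounded_gt_monotone_of_wellQuasiOrdered {α I : Type*} {ρ : α → α → Prop}
    [IsPreorder α ρ] (hρ : WellQuasiOrdered ρ) [PartialOrder I] [WellFoundedGT I] :
    WellFounded fun f g : {f : α → I // ∀ a b, ρ a b → f a ≤ f b} => g.1 < f.1 := by
  rw [wellFounded_iff_isEmpty_descending_chain]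
  refine ⟨fun ⟨f, hf⟩ => ?_⟩
  -- `f k` grows strictly at `p k`; along a `ρ`-increasing subsequence of `p` the values ascend
  have hmono : Monotone fun k => (f k).1 := monotone_nat_of_le_succ fun k => (hf k).le
  choose p hp using fun k => (Pi.lt_def.1 (hf k)).2
  obtain ⟨g, hg⟩ := hρ.exists_monotone_subseq p
  refine not_strictMono_of_wellFoundedGT (fun k => (f (g k)).1 (p (g k)))
    (strictMono_nat_of_lt_succ fun k => ?_)
  calc (f (g k)).1 (p (g k)) < (f (g k + 1)).1 (p (g k)) := hp _
    _ ≤ (f (g (k + 1))).1 (p (g k)) := hmono (g.strictMono (Nat.lt_succ_self k)) _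
    _ ≤ (f (g (k + 1))).1 (p (g (k + 1))) := (f _).2 _ _ (hg _ _ (Nat.le_succ k))

variable [LinearOrder (ModMon n r)]

lemma IsMonomialOrder.translate_le (hord : IsMonomialOrder n r) {m m' : ModMon n r}
    (h : m ≤ m') (δ : Fin n → ℕ) : m.translate δ ≤ m'.translate δ :=
  hord.mul_le_mul _ _ δ _ _ h

lemma IsMonomialOrder.translate_lt (hord : IsMonomialOrder n r) {m m' : ModMon n r}
    (h : m < m') (δ : Fin n → ℕ) : m.translate δ < m'.translate δ :=
  (hord.translate_le h.le δ).lt_of_ne fun e => h.ne (ModMon.translate_left_injective δ e)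

lemma IsMonomialOrder.le_of_divides (hord : IsMonomialOrder n r) {m m' : ModMon n r}
    (h : m.Divides m') : m ≤ m' := by
  rw [← h.translate_sub]
  exact hord.le_mul _ _ _

lemma IsMonomialOrder.wellFoundedLT (hord : IsMonomialOrder n r) : WellFoundedLT (ModMon n r) := by
  have : WellQuasiOrderedLE (ModMon n r) := ⟨fun f => by
    obtain ⟨i, j, hij, h⟩ := ModMon.wellQuasiOrdered_divides f
    exact ⟨i, j, hij, hord.le_of_divides h⟩⟩
  infer_instance

end Order

/-! ### Supports and leading monomials -/

section Support

variable {A : Type*} [Ring A] {R : Subring A} {n : ℕ} {x : Fin n → A} {r s t : ℕ}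

/-- All monomials of the vector `f` lie in `S`. With `S = Set.Iic m` this bounds the leading
monomial of `f` by `m`, the zero vector included. -/
def SuppIn (h : IsExtension R x) (S : Set (ModMon n r)) (f : Fin r → A) : Prop :=
  ∀ m, coeff h f m ≠ 0 → m ∈ S

section

variable (h : IsExtension R x)

@[simp] lemma coeff_zero (m : ModMon n r) : coeff h 0 m = 0 := by simp [coeff]

lemma coeff_add (f g : Fin r → A) (m : ModMon n r) :
    coeff h (f + g) m = coeff h f m + coeff h g m := by simp [coeff]

lemma coeff_sub (f g : Fin r → A) (m : ModMon n r) :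
    coeff h (f - g) m = coeff h f m - coeff h g m := by simp [coeff]

variable {h}

lemma SuppIn.mono {S T : Set (ModMon n r)} {f : Fin r → A} (hf : SuppIn h S f) (hST : S ⊆ T) :
    SuppIn h T f := fun m hm => hST (hf m hm)

lemma SuppIn.coeff_eq_zero {S : Set (ModMon n r)} {f : Fin r → A} (hf : SuppIn h S f)
    {m : ModMon n r} (hm : m ∉ S) : coeff h f m = 0 := by
  by_contra hne
  exact hm (hf m hne)

lemma SuppIn.sub {S : Set (ModMon n r)} {f g : Fin r → A} (hf : SuppIn h S f)
    (hg : SuppIn h S g) : SuppIn h S (f - g) := by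
  intro m hm
  by_contra hS
  exact hm (by rw [coeff_sub, hf.coeff_eq_zero hS, hg.coeff_eq_zero hS, sub_zero])

lemma eq_zero_of_coeff_eq_zero {f : Fin r → A} (hf : ∀ m, coeff h f m = 0) : f = 0 := by
  funext i
  refine h.basis.repr.map_eq_zero_iff.1 (Finsupp.ext fun α => ?_)
  exact hf ⟨α, i⟩

end

variable [LinearOrder (ModMon n r)] {h : IsExtension R x}

lemma exists_isLeadingMonomial {f : Fin r → A} (hf : f ≠ 0) :
    ∃ m, IsLeadingMonomial h f m := by
  have hfin : {m | coeff h f m ≠ 0}.Finite := by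
    refine (Set.finite_iUnion fun i : Fin r => ((h.basis.repr (f i)).support.finite_toSet.image
      fun α => (⟨α, i⟩ : ModMon n r))).subset fun m hm => ?_
    exact Set.mem_iUnion.2 ⟨m.idx, m.exp, Finsupp.mem_support_iff.2 hm, rfl⟩
  have hne : {m | coeff h f m ≠ 0}.Nonempty := by
    by_contra hemp
    exact hf (eq_zero_of_coeff_eq_zero fun m => by
      by_contra hm
      exact hemp ⟨m, hm⟩)
  obtain ⟨m, hm, hmax⟩ := hfin.exists_maximal hne
  refine ⟨m, hm, fun m' hlt => ?_⟩
  by_contra hm'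
  exact hlt.not_ge (hmax hm' hlt.le)

lemma IsLeadingMonomial.suppIn {f : Fin r → A} {m : ModMon n r} (hf : IsLeadingMonomial h f m) :
    SuppIn h (Set.Iic m) f := fun m' hm' => not_lt.1 fun hlt => hm' (hf.2 m' hlt)

lemma IsLeadingMonomial.mem_of_suppIn {f : Fin r → A} {m : ModMon n r} {S : Set (ModMon n r)}
    (hf : IsLeadingMonomial h f m) (hS : SuppIn h S f) : m ∈ S := hS m hf.1

lemma IsLeadingMonomial.unique {f : Fin r → A} {m m' : ModMon n r}
    (hf : IsLeadingMonomial h f m) (hf' : IsLeadingMonomial h f m') : m = m' :=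
  le_antisymm (hf.mem_of_suppIn hf'.suppIn) (hf'.mem_of_suppIn hf.suppIn)

lemma IsLeadingMonomial.ne_zero {f : Fin r → A} {m : ModMon n r}
    (hf : IsLeadingMonomial h f m) : f ≠ 0 := by
  rintro rfl
  exact hf.1 (coeff_zero h m)

lemma SuppIn.Iio_of_coeff_eq_zero {f : Fin r → A} {m : ModMon n r} (hf : SuppIn h (Set.Iic m) f)
    (hm : coeff h f m = 0) : SuppIn h (Set.Iio m) f :=
  fun m' hm' => (hf m' hm').lt_of_ne fun e => hm' (e ▸ hm)

/-- Multiplication of a vector by an element whose monomials `x^γ` satisfy `x^γ m ∈ S` for a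
bound `m` of the monomials of the vector. -/
lemma SuppIn.mul (hA : IsBijectiveExtension R x) (hord : IsMonomialOrder n r)
    {S : Set (ModMon n r)} (hS : IsLowerSet S) {m : ModMon n r} {f : Fin r → A}
    (hf : SuppIn hA.toIsExtension (Set.Iic m) f) {a : A}
    (ha : ∀ γ, hA.basis.repr a γ ≠ 0 → m.translate γ ∈ S) :
    SuppIn hA.toIsExtension S (MulOpposite.op a • f) := by
  intro m' hm'
  obtain ⟨δ, γ, hδ, hγ, hor⟩ := hA.exists_of_repr_mul_ne_zero hm'
  refine hS ?_ (ha γ hγ)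
  have h1 : (⟨δ + γ, m'.idx⟩ : ModMon n r) ≤ m.translate γ :=
    hord.translate_le (hf ⟨δ, m'.idx⟩ hδ) γ
  refine le_trans ?_ h1
  rcases hor with e | hlt
  · exact (ModMon.ext e rfl : m' = ⟨δ + γ, m'.idx⟩).le
  · refine (hord.degree_compatible m'.exp (δ + γ) m'.idx ?_).le
    simpa [Finset.sum_add_distrib] using hlt

/-- The coefficient of `f (b x^γ)` at the translate by `γ` of a bound of the monomials of `f`. -/
lemma IsBijectiveExtension.coeff_translate (hA : IsBijectiveExtension R x)
    (hord : IsMonomialOrder n r) (m : ModMon n r) (γ : Fin n → ℕ) :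
    ∃ (τ : R ≃+* R) (c : Rˣ), ∀ (f : Fin r → A) (b : R),
      SuppIn hA.toIsExtension (Set.Iic m) f →
      coeff hA.toIsExtension (MulOpposite.op (b * mon x γ) • f) (m.translate γ) =
        coeff hA.toIsExtension f m * (τ b * (c : R)) := by
  obtain ⟨τ, c, h⟩ := hA.repr_mul_top m.exp γ
  refine ⟨τ, c, fun f b hf => h (f m.idx) b fun δ hδ => ?_⟩
  by_contra! hlt
  exact (hord.degree_compatible _ _ m.idx hlt).not_ge (hf ⟨δ, m.idx⟩ hδ)

end Support

/-! ### Quotients bounded by a monomial -/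

section Quotients

variable {A : Type*} [Ring A] {R : Subring A} {n : ℕ} {x : Fin n → A} {r s t : ℕ}

/-- Prescribing the leading coefficient of `x^γ ρ x^δ`. -/
lemma IsBijectiveExtension.exists_repr_eq (hA : IsBijectiveExtension R x) (γ δ : Fin n → ℕ)
    (v : R) : ∃ ρ : R, hA.basis.repr (mon x γ * (ρ * mon x δ)) (γ + δ) = v ∧
      ∀ η, η ≠ γ + δ → hA.basis.repr (mon x γ * (ρ * mon x δ)) η ≠ 0 →
        ∑ i, η i < ∑ i, (γ + δ) i := by
  obtain ⟨τ, c, h⟩ := hA.repr_mon_mul_mon γ δ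
  have hsum : ∑ i, (γ + δ) i = ∑ i, γ i + ∑ i, δ i := by simp [Finset.sum_add_distrib]
  refine ⟨τ.symm (v * (c⁻¹ : Rˣ)), ?_, fun η hη hne => ?_⟩
  · rw [h _ _ hsum.ge, if_pos rfl]
    simp
  · by_contra! hle
    exact hne (by rw [h _ _ (hsum ▸ hle), if_neg hη])

lemma IsBijectiveExtension.repr_mon_mul_coeff (hA : IsBijectiveExtension R x) {γ η : Fin n → ℕ}
    {ρ : R} (hη : hA.basis.repr (mon x γ * ρ) η ≠ 0) : η = γ ∨ ∑ i, η i < ∑ i, γ i := by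
  obtain ⟨τ, c, h⟩ := hA.repr_mon_mul_mon γ 0
  by_contra! hne
  apply hη
  have := h ρ η (by simpa using hne.2)
  rwa [mon_zero, mul_one, add_zero, if_neg hne.1] at this

variable [LinearOrder (ModMon n r)]

/-- In the combination `G u` of the columns of `G`, all products of a leading monomial of a column
with a monomial of its coefficient lie in `S`. Taking for `S` the monomials `≤ m` or `< m`, this
expresses that `G u` is a representation bounded by `m`. -/
def IsQuot (h : IsExtension R x) (G : Matrix (Fin r) (Fin t) A) (S : Set (ModMon n r))
    (u : Fin t → A) : Prop :=
  ∀ j m, IsLeadingMonomial h (G.col j) m → ∀ γ, h.basis.repr (u j) γ ≠ 0 → m.translate γ ∈ S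

section

variable {h : IsExtension R x} {G : Matrix (Fin r) (Fin t) A} {S T : Set (ModMon n r)}
  {u v : Fin t → A}

lemma IsQuot.zero : IsQuot h G S 0 := fun j m _ γ hγ => by simp at hγ

lemma IsQuot.add (hu : IsQuot h G S u) (hv : IsQuot h G S v) : IsQuot h G S (u + v) := by
  intro j m hm γ hγ
  by_contra hS
  have h1 : h.basis.repr (u j) γ = 0 := by_contra fun hne => hS (hu j m hm γ hne)
  have h2 : h.basis.repr (v j) γ = 0 := by_contra fun hne => hS (hv j m hm γ hne)
  exact hγ (by simp [h1, h2])

lemma IsQuot.mono (hu : IsQuot h G S u) (hST : S ⊆ T) : IsQuot h G T u :=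
  fun j m hm γ hγ => hST (hu j m hm γ hγ)

/-- A non-zero combination of the columns of `G` is bounded by the largest of the products of
leading monomials of columns with monomials of their coefficients. -/
lemma exists_isQuot_Iic (hGu : G *ᵥ u ≠ 0) :
    ∃ j m γ, IsLeadingMonomial h (G.col j) m ∧ h.basis.repr (u j) γ ≠ 0 ∧
      IsQuot h G (Set.Iic (m.translate γ)) u := by
  set P : Set (ModMon n r) := {μ | ∃ j m γ, IsLeadingMonomial h (G.col j) m ∧
    h.basis.repr (u j) γ ≠ 0 ∧ μ = m.translate γ} with hP
  have hfin : P.Finite := by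
    have : Nonempty (ModMon n r) := by
      obtain ⟨i, -⟩ := Function.ne_iff.1 hGu
      exact ⟨⟨0, i⟩⟩
    choose! l hl using fun j (hj : ∃ m, IsLeadingMonomial h (G.col j) m) => hj
    refine (Set.finite_iUnion fun j : Fin t =>
      ((h.basis.repr (u j)).support.finite_toSet.image (l j).translate)).subset ?_
    rintro _ ⟨j, m, γ, hm, hγ, rfl⟩
    exact Set.mem_iUnion.2 ⟨j, γ, Finsupp.mem_support_iff.2 hγ, by rw [hm.unique (hl j ⟨m, hm⟩)]⟩
  have hne : P.Nonempty := by
    by_contra hemp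
    refine hGu ?_
    rw [Matrix.mulVec_eq_sum]
    refine Finset.sum_eq_zero fun j _ => ?_
    by_cases hj : G.col j = 0
    · rw [show Gᵀ j = 0 from hj, smul_zero]
    · obtain ⟨m, hm⟩ := exists_isLeadingMonomial (h := h) hj
      have : u j = 0 := by
        refine h.basis.repr.map_eq_zero_iff.1 (Finsupp.ext fun γ => ?_)
        by_contra hγ
        exact hemp ⟨_, j, m, γ, hm, hγ, rfl⟩
      rw [this, MulOpposite.op_zero, zero_smul]
  obtain ⟨μ, ⟨j, m, γ, hm, hγ, rfl⟩, hmax⟩ := hfin.exists_maximal hne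
  refine ⟨j, m, γ, hm, hγ, fun j' m' hm' γ' hγ' => ?_⟩
  by_contra hlt
  exact hlt (hmax ⟨j', m', γ', hm', hγ', rfl⟩ (not_le.1 hlt).le)

end

variable (hA : IsBijectiveExtension R x)
  {G : Matrix (Fin r) (Fin t) A} {S T : Set (ModMon n r)}
  {u v : Fin t → A}

lemma IsQuot.smul (hord : IsMonomialOrder n r) (hu : IsQuot hA.toIsExtension G S u)
    (hT : IsLowerSet T) {δ : Fin n → ℕ} (hST : ∀ m ∈ S, m.translate δ ∈ T) (b : R) :
    IsQuot hA.toIsExtension G T (MulOpposite.op (b * mon x δ) • u) := by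
  intro j m hm η hη
  obtain ⟨γ, δ', hγ, hδ', hor⟩ := hA.exists_of_repr_mul_ne_zero hη
  obtain rfl : δ = δ' := by
    by_contra hne
    have e : (b : A) * mon x δ = b • mon x δ := rfl
    rw [MulOpposite.unop_op, e, map_smul, hA.repr_mon, Finsupp.smul_apply,
      Finsupp.single_eq_of_ne (Ne.symm hne)] at hδ'
    simp at hδ'
  have h1 := hST _ (hu j m hm γ hγ)
  rcases hor with rfl | hlt
  · rwa [ModMon.translate_add]
  · refine hT (hord.degree_compatible _ _ m.idx ?_).le h1
    simp only [Pi.add_apply, Finset.sum_add_distrib, ModMon.translate]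
    omega

/-- The vector represented has no other monomials than its bounded representation allows. -/
lemma IsQuot.suppIn (hord : IsMonomialOrder n r) (hu : IsQuot hA.toIsExtension G S u)
    (hS : IsLowerSet S) : SuppIn hA.toIsExtension S (G *ᵥ u) := by
  rw [Matrix.mulVec_eq_sum]
  refine Finset.sum_induction _ (SuppIn hA.toIsExtension S) (fun f g hf hg => ?_) ?_ ?_
  · intro m hm
    by_contra hmS
    exact hm (by rw [coeff_add, hf.coeff_eq_zero hmS, hg.coeff_eq_zero hmS, add_zero])
  · intro m hm
    simp at hm
  · intro j _
    by_cases hj : G.col j = 0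
    · rw [show Gᵀ j = 0 from hj, smul_zero]
      intro m hm
      simp at hm
    · obtain ⟨m, hm⟩ := exists_isLeadingMonomial (h := hA.toIsExtension) hj
      exact SuppIn.mul hA hord hS hm.suppIn (hu j m hm)

lemma IsTermVector.isQuot (hord : IsMonomialOrder n r) {m : ModMon n r}
    (hu : IsTermVector hA.toIsExtension G m u) : IsQuot hA.toIsExtension G (Set.Iic m) u := by
  intro j μ hμ η hη
  rcases hu j with h0 | ⟨β, γ, ρ, hβ, hsum, hj⟩
  · simp [h0] at hη
  · obtain rfl := hμ.unique hβ
    have hm : m = (⟨β, m.idx⟩ : ModMon n r).translate γ := ModMon.ext hsum.symm rfl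
    rw [hj] at hη
    rcases hA.repr_mon_mul_coeff hη with rfl | hlt
    · exact hm.ge
    · rw [Set.mem_Iic]
      conv_rhs => rw [hm]
      refine (hord.degree_compatible _ _ m.idx ?_).le
      simpa [Finset.sum_add_distrib] using hlt

/-- A representation bounded by `m` is the sum of a vector of terms at `m` and a representation
with all monomials less than `m`. -/
lemma IsQuot.exists_isTermVector (hord : IsMonomialOrder n r) {m : ModMon n r}
    (hu : IsQuot hA.toIsExtension G (Set.Iic m) u) :
    ∃ q, IsTermVector hA.toIsExtension G m q ∧
      IsQuot hA.toIsExtension G (Set.Iio m) (u - q) := by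
  -- `a` is the term of `u j` which contributes to `m`, if there is one, with its coefficient
  -- moved to the right of the monomial
  have key : ∀ j, ∃ a : A, (a = 0 ∨ ∃ (β γ : Fin n → ℕ) (ρ : R),
      IsLeadingMonomial hA.toIsExtension (G.col j) ⟨β, m.idx⟩ ∧ β + γ = m.exp ∧
        a = mon x γ * ρ) ∧ ∀ μ, IsLeadingMonomial hA.toIsExtension (G.col j) μ →
      ∀ η, hA.basis.repr (u j - a) η ≠ 0 → μ.translate η < m := by
    intro j
    by_cases hex : ∃ β γ, IsLeadingMonomial hA.toIsExtension (G.col j) ⟨β, m.idx⟩ ∧ β + γ = m.exp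
    · obtain ⟨β, γ, hβ, hsum⟩ := hex
      obtain ⟨ρ, hρ, hlow⟩ := hA.exists_repr_eq γ 0 (hA.basis.repr (u j) γ)
      rw [mon_zero, mul_one, add_zero] at hρ hlow
      refine ⟨mon x γ * ρ, Or.inr ⟨β, γ, ρ, hβ, hsum, rfl⟩, fun μ hμ η hη => ?_⟩
      obtain rfl := hμ.unique hβ
      have hm : (⟨β, m.idx⟩ : ModMon n r).translate γ = m := ModMon.ext hsum rfl
      have hne : η ≠ γ := by
        rintro rfl
        rw [map_sub, Finsupp.sub_apply, hρ, sub_self] at hη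
        exact hη rfl
      by_cases huη : hA.basis.repr (u j) η = 0
      · rw [map_sub, Finsupp.sub_apply, huη, zero_sub, neg_ne_zero] at hη
        rw [← hm]
        refine hord.degree_compatible _ _ m.idx ?_
        simpa [Finset.sum_add_distrib] using hlow η hne hη
      · exact (hu j _ hβ η huη).lt_of_ne fun e =>
          hne (ModMon.translate_right_injective _ (e.trans hm.symm))
    · refine ⟨0, Or.inl rfl, fun μ hμ η hη => ?_⟩
      rw [sub_zero] at hη
      refine lt_of_le_of_ne (hu j μ hμ η hη) fun e => hex ⟨μ.exp, η, ?_, congrArg ModMon.exp e⟩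
      have : (μ.translate η).idx = m.idx := congrArg ModMon.idx e
      change μ.idx = m.idx at this
      rwa [← this]
  choose q hq hlow using key
  exact ⟨q, hq, fun j μ hμ η hη => hlow j μ hμ η hη⟩

end Quotients

/-! ### Buchberger's criterion -/

section Criterion

variable {A : Type*} [Ring A] {R : Subring A} {n : ℕ} {x : Fin n → A} {r s t : ℕ}
  [LinearOrder (ModMon n r)] (hA : IsBijectiveExtension R x)
  {G : Matrix (Fin r) (Fin t) A}

/-- A syzygy of leading terms at `m` is, up to a representation below `m`, the translate of a
syzygy at a least common multiple dividing `m`. -/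
lemma IsLeadingSyzygy.exists_isLcm (hord : IsMonomialOrder n r) {m : ModMon n r} {q : Fin t → A}
    (hq : IsLeadingSyzygy hA.toIsExtension G m q) (hne : q ≠ 0) :
    ∃ m' q', IsLcm hA.toIsExtension G m' ∧ m'.Divides m ∧
      IsLeadingSyzygy hA.toIsExtension G m' q' ∧
      IsQuot hA.toIsExtension G (Set.Iio m)
        (q - MulOpposite.op (mon x (m.exp - m'.exp)) • q') := by
  classical
  obtain ⟨hterm, hcoeff⟩ := hq
  set J : Finset (Fin t) := Finset.univ.filter fun j => q j ≠ 0 with hJ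
  have hJne : J.Nonempty := by
    obtain ⟨j, hj⟩ := Function.ne_iff.1 hne
    exact ⟨j, by simpa [hJ] using hj⟩
  have hex : ∀ j, ∃ (β γ : Fin n → ℕ) (ρ : R), j ∈ J →
      IsLeadingMonomial hA.toIsExtension (G.col j) ⟨β, m.idx⟩ ∧ β + γ = m.exp ∧
        q j = mon x γ * ρ := by
    intro j
    rcases hterm j with h0 | ⟨β, γ, ρ, h⟩
    · exact ⟨0, 0, 0, fun hj => absurd h0 (by simpa [hJ] using hj)⟩
    · exact ⟨β, γ, ρ, fun _ => h⟩
  choose β γ ρ hβ using hex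
  set m' : ModMon n r := ⟨J.sup β, m.idx⟩ with hm'
  have hdiv : m'.Divides m := ⟨Finset.sup_le fun j hj => by
    have h1 : β j ≤ β j + γ j := fun i => Nat.le_add_right _ _
    rwa [(hβ j hj).2.1] at h1, rfl⟩
  set δ := m.exp - m'.exp with hδ
  have hexp : ∀ j ∈ J, (m'.exp - β j) + δ = γ j := by
    intro j hj
    have h1 : β j ≤ m'.exp := Finset.le_sup hj
    funext i
    have h2 := congrFun (hβ j hj).2.1 i
    have h3 := h1 i
    have h4 := hdiv.1 i
    simp only [hδ, Pi.add_apply, Pi.sub_apply] at h2 h3 h4 ⊢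
    omega
  -- `ρ' j` is chosen such that `x^(m' - β_j) ρ' x^δ` and `q j` have the same leading coefficient
  choose ρ' hρ' hlow using fun j =>
    hA.exists_repr_eq (m'.exp - β j) δ (hA.basis.repr (q j) (γ j))
  set q' : Fin t → A := fun j => if j ∈ J then mon x (m'.exp - β j) * ρ' j else 0 with hq'
  have hterm' : IsTermVector hA.toIsExtension G m' q' := by
    intro j
    by_cases hj : j ∈ J
    · exact Or.inr ⟨β j, m'.exp - β j, ρ' j, (hβ j hj).1,
        add_tsub_cancel_of_le (Finset.le_sup hj : β j ≤ m'.exp), by simp [hq', hj]⟩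
    · exact Or.inl (by simp [hq', hj])
  have hrest : IsQuot hA.toIsExtension G (Set.Iio m) (q - MulOpposite.op (mon x δ) • q') := by
    intro j μ hμ η hη
    by_cases hj : j ∈ J
    · obtain rfl := hμ.unique (hβ j hj).1
      have hm : (⟨β j, m.idx⟩ : ModMon n r).translate (γ j) = m :=
        ModMon.ext (hβ j hj).2.1 rfl
      have e : (q - MulOpposite.op (mon x δ) • q') j =
          mon x (γ j) * ρ j - mon x (m'.exp - β j) * (ρ' j * mon x δ) := by
        simp [hq', hj, (hβ j hj).2.2, mul_assoc]
      have hlow' := hlow j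
      have hρ'' := hρ' j
      rw [hexp j hj] at hlow' hρ''
      rw [(hβ j hj).2.2] at hρ''
      have hηγ : η ≠ γ j := by
        rintro rfl
        rw [e, map_sub, Finsupp.sub_apply, hρ'', sub_self] at hη
        exact hη rfl
      rw [← hm]
      refine hord.degree_compatible _ _ m.idx ?_
      have : ∑ i, η i < ∑ i, γ j i := by
        by_contra hle
        have h1 : hA.basis.repr (mon x (γ j) * ρ j) η = 0 := by
          by_contra h1
          exact (hA.repr_mon_mul_coeff h1).elim hηγ hle
        have h2 : hA.basis.repr (mon x (m'.exp - β j) * (ρ' j * mon x δ)) η = 0 := by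
          by_contra h2
          exact hle (hlow' η hηγ h2)
        rw [e, map_sub, Finsupp.sub_apply, h1, h2, sub_zero] at hη
        exact hη rfl
      simpa [Finset.sum_add_distrib] using this
    · have h0 : q j = 0 := by simpa [hJ] using hj
      simp [hq', hj, h0] at hη
  refine ⟨m', q', ⟨J, β, hJne, fun j hj => (hβ j hj).1, rfl⟩, hdiv, ⟨hterm', ?_⟩, hrest⟩
  -- the coefficient of `G q'` at `m'`, times a unit, is that of `G q` at `m`, which is zero
  obtain ⟨τ, c, htop⟩ := hA.coeff_translate hord m' δ
  have h1 := htop (G *ᵥ q') 1 ((hterm'.isQuot hA hord).suppIn hA hord (isLowerSet_Iic m'))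
  have h2 := (hrest.suppIn hA hord (isLowerSet_Iio m)).coeff_eq_zero (lt_irrefl m)
  rw [Matrix.mulVec_sub, coeff_sub, hcoeff, zero_sub, neg_eq_zero, Matrix.mulVec_smul] at h2
  rw [hdiv.translate_sub, Subring.coe_one, one_mul, h2, map_one, one_mul] at h1
  exact (c.isUnit.mul_left_eq_zero).1 h1.symm

/-- Syzygies in the span of syzygies whose S-vectors have representations below `m` have such
representations themselves. -/
lemma exists_isQuot_of_mem_span (hord : IsMonomialOrder n r) {m : ModMon n r}
    {P : Set (Fin t → A)} (hP : ∀ p ∈ P, ∃ u, IsQuot hA.toIsExtension G (Set.Iio m) u ∧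
      G *ᵥ u = G *ᵥ p) {q : Fin t → A} (hq : q ∈ Submodule.span R.op P) :
    ∃ u, IsQuot hA.toIsExtension G (Set.Iio m) u ∧ G *ᵥ u = G *ᵥ q := by
  induction hq using Submodule.span_induction with
  | mem p hp => exact hP p hp
  | zero => exact ⟨0, IsQuot.zero, rfl⟩
  | add p p' _ _ hp hp' =>
    obtain ⟨u, hu, e⟩ := hp
    obtain ⟨u', hu', e'⟩ := hp'
    exact ⟨u + u', hu.add hu', by rw [Matrix.mulVec_add, Matrix.mulVec_add, e, e']⟩
  | smul ρ p _ hp =>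
    obtain ⟨u, hu, e⟩ := hp
    have h1 := hu.smul hA hord (isLowerSet_Iio m) (δ := 0)
      (fun m hm => by rwa [ModMon.translate_zero]) ⟨_, ρ.2⟩
    rw [mon_zero, mul_one, MulOpposite.op_unop] at h1
    exact ⟨_, h1, by rw [Matrix.mulVec_smul, e, ← Matrix.mulVec_smul]; rfl⟩

/-- Buchberger's criterion: if the S-vectors of generators of the syzygies of leading terms at
least common multiples `m` have representations below `m`, then every non-zero combination of the
columns of `G` is reducible. -/
theorem isReducible_of_isSyzygyList (hord : IsMonomialOrder n r) {B : List (Fin t → A)}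
    (hB : IsSyzygyList hA.toIsExtension G B)
    (hred : ∀ q ∈ B, ∀ m, IsLeadingSyzygy hA.toIsExtension G m q →
      ∃ u, IsQuot hA.toIsExtension G (Set.Iio m) u ∧ G *ᵥ u = G *ᵥ q)
    {u : Fin t → A} (hu : G *ᵥ u ≠ 0) : IsReducible hA.toIsExtension G (G *ᵥ u) := by
  have := hord.wellFoundedLT
  obtain ⟨j, μ, γ, -, -, hq⟩ := exists_isQuot_Iic (h := hA.toIsExtension) hu
  -- induction on a bound `m` of a representation
  generalize μ.translate γ = m at hq
  induction m using WellFoundedLT.induction generalizing u with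
  | _ m ih =>
    obtain ⟨q, hterm, hlow⟩ := hq.exists_isTermVector hA hord
    have hc : coeff hA.toIsExtension (G *ᵥ q) m = coeff hA.toIsExtension (G *ᵥ u) m := by
      have := (hlow.suppIn hA hord (isLowerSet_Iio m)).coeff_eq_zero (lt_irrefl m)
      rw [Matrix.mulVec_sub, coeff_sub, sub_eq_zero] at this
      exact this.symm
    by_cases h0 : coeff hA.toIsExtension (G *ᵥ u) m = 0
    -- the terms at `m` cancel, so they can be replaced by smaller ones
    · obtain ⟨v, hv, hvu⟩ : ∃ v, IsQuot hA.toIsExtension G (Set.Iio m) v ∧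
          G *ᵥ v = G *ᵥ u := by
        by_cases hq0 : q = 0
        · exact ⟨u, by simpa [hq0] using hlow, rfl⟩
        obtain ⟨m', q', hlcm, hdiv, hsyz, hrest⟩ :=
          IsLeadingSyzygy.exists_isLcm hA hord ⟨hterm, hc.trans h0⟩ hq0
        obtain ⟨w, hw, hwq⟩ := exists_isQuot_of_mem_span hA hord
          (fun p hp => hred p hp.1 m' hp.2) (hB.2 m' hlcm q' hsyz)
        have h1 := hw.smul hA hord (isLowerSet_Iio m) (δ := m.exp - m'.exp) (fun μ hμ => by
          have := hord.translate_lt hμ (m.exp - m'.exp)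
          rwa [hdiv.translate_sub] at this) 1
        rw [Subring.coe_one, one_mul] at h1
        refine ⟨_, (hlow.add hrest).add h1, ?_⟩
        rw [Matrix.mulVec_add, Matrix.mulVec_smul, hwq, ← Matrix.mulVec_smul, ← Matrix.mulVec_add]
        congr 1
        abel
      obtain ⟨j, μ, γ, hμ, hγ, hv'⟩ := exists_isQuot_Iic (h := hA.toIsExtension)
        (show G *ᵥ v ≠ 0 by rwa [hvu])
      rw [← hvu]
      exact ih _ (hv j μ hμ γ hγ) (by rwa [hvu]) hv'
    -- the terms at `m` do not cancel, so they reduce the vector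
    · refine ⟨q, m, ⟨h0, fun m' hm' => ?_⟩, hterm, hc⟩
      exact (hq.suppIn hA hord (isLowerSet_Iic m)).coeff_eq_zero (not_le.2 hm')

end Criterion

/-! ### Finitely many generators of the syzygies -/

section Syzygies

variable {A : Type*} [Ring A] {R : Subring A} {n : ℕ} {x : Fin n → A} {r s t : ℕ}
  [LinearOrder (ModMon n r)] (hA : IsBijectiveExtension R x) {G : Matrix (Fin r) (Fin t) A}

lemma IsTermVector.add {h : IsExtension R x} {m : ModMon n r} {p q : Fin t → A}
    (hp : IsTermVector h G m p) (hq : IsTermVector h G m q) : IsTermVector h G m (p + q) := by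
  intro j
  rcases hp j with h0 | ⟨β, γ, ρ, hβ, hγ, hj⟩
  · simpa [h0] using hq j
  rcases hq j with h0 | ⟨β', γ', ρ', hβ', hγ', hj'⟩
  · exact Or.inr ⟨β, γ, ρ, hβ, hγ, by simpa [h0] using hj⟩
  obtain rfl : β = β' := congrArg ModMon.exp (hβ.unique hβ')
  obtain rfl : γ = γ' := add_left_cancel (hγ.trans hγ'.symm)
  exact Or.inr ⟨β, γ, ρ + ρ', hβ, hγ, by simp [hj, hj', mul_add]⟩

lemma IsTermVector.smul {h : IsExtension R x} {m : ModMon n r} {p : Fin t → A}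
    (hp : IsTermVector h G m p) (b : R) : IsTermVector h G m (MulOpposite.op (b : A) • p) := by
  intro j
  rcases hp j with h0 | ⟨β, γ, ρ, hβ, hγ, hj⟩
  · exact Or.inl (by simp [h0])
  · exact Or.inr ⟨β, γ, ρ * b, hβ, hγ, by simp [hj, mul_assoc]⟩

/-- The right `R`-module of the syzygies of leading terms at `m`. -/
def leadingSyzygies (hord : IsMonomialOrder n r) (G : Matrix (Fin r) (Fin t) A)
    (m : ModMon n r) : Submodule R.op (Fin t → A) where
  carrier := {q | IsLeadingSyzygy hA.toIsExtension G m q}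
  zero_mem' := ⟨fun _ => Or.inl rfl, by simp⟩
  add_mem' hp hq := ⟨hp.1.add hq.1, by
    rw [Matrix.mulVec_add, coeff_add, hp.2, hq.2, add_zero]⟩
  smul_mem' ρ p hp := by
    refine ⟨hp.1.smul ⟨_, ρ.2⟩, ?_⟩
    obtain ⟨τ, c, h⟩ := hA.coeff_translate hord m 0
    have := h (G *ᵥ p) ⟨_, ρ.2⟩ ((hp.1.isQuot hA hord).suppIn hA hord (isLowerSet_Iic m))
    rw [mon_zero, mul_one, ModMon.translate_zero, MulOpposite.op_unop, hp.2, zero_mul,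
      ← Matrix.mulVec_smul] at this
    exact this

/-- The vectors of terms at `m` lie in the image of the Noetherian right module `R^t` under
`(ρ_j)_j ↦ (x^{γ_j} ρ_j)_j`. -/
lemma leadingSyzygies_fg (hord : IsMonomialOrder n r) (hR : IsNoetherianRing (R : Type _)ᵐᵒᵖ)
    (m : ModMon n r) : (leadingSyzygies hA hord G m).FG := by
  have : IsNoetherianRing R.op := isNoetherianRing_of_ringEquiv _ R.mopRingEquivOp
  have hex : ∀ j, ∃ a : A, ∀ (β γ : Fin n → ℕ),
      IsLeadingMonomial hA.toIsExtension (G.col j) ⟨β, m.idx⟩ → β + γ = m.exp → a = mon x γ := by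
    intro j
    by_cases hex : ∃ β γ, IsLeadingMonomial hA.toIsExtension (G.col j) ⟨β, m.idx⟩ ∧ β + γ = m.exp
    · obtain ⟨β, γ, hβ, hγ⟩ := hex
      refine ⟨mon x γ, fun β' γ' hβ' hγ' => ?_⟩
      obtain rfl : β = β' := congrArg ModMon.exp (hβ.unique hβ')
      rw [add_left_cancel (hγ.trans hγ'.symm)]
    · exact ⟨0, fun β γ hβ hγ => absurd ⟨β, γ, hβ, hγ⟩ hex⟩
  choose a ha using hex
  let φ : (Fin t → R.op) →ₗ[R.op] (Fin t → A) :=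
    LinearMap.pi fun j => (LinearMap.toSpanSingleton R.op A (a j)).comp (LinearMap.proj j)
  have hle : leadingSyzygies hA hord G m ≤ LinearMap.range φ := by
    intro q hq
    have : ∀ j, ∃ ρ : R.op, ρ • a j = q j := by
      intro j
      rcases hq.1 j with h0 | ⟨β, γ, ρ, hβ, hγ, hj⟩
      · exact ⟨0, by simp [h0]⟩
      · exact ⟨⟨MulOpposite.op (ρ : A), ρ.2⟩, by rw [ha j β γ hβ hγ, hj]; rfl⟩
    choose ρ hρ using this
    exact ⟨ρ, funext hρ⟩
  rw [← Submodule.map_comap_eq_of_le hle]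
  exact (IsNoetherian.noetherian _).map φ

/-- A least common multiple is determined by the set of columns it is taken of. -/
lemma finite_setOf_isLcm (h : IsExtension R x) : {m | IsLcm h G m}.Finite := by
  have hsub : ∀ J : Finset (Fin t), {m : ModMon n r | ∃ β : Fin t → Fin n → ℕ, J.Nonempty ∧
      (∀ j ∈ J, IsLeadingMonomial h (G.col j) ⟨β j, m.idx⟩) ∧ m.exp = J.sup β}.Subsingleton := by
    rintro J m ⟨β, ⟨j, hj⟩, hβ, hm⟩ m' ⟨β', -, hβ', hm'⟩
    refine ModMon.ext ?_ (ModMon.mk.inj ((hβ j hj).unique (hβ' j hj))).2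
    rw [hm, hm']
    exact Finset.sup_congr rfl fun j hj => congrArg ModMon.exp ((hβ j hj).unique (hβ' j hj))
  refine (Set.finite_iUnion fun J => (hsub J).finite).subset ?_
  rintro m ⟨J, β, h⟩
  exact Set.mem_iUnion.2 ⟨J, β, h⟩

lemma exists_isSyzygyList (hord : IsMonomialOrder n r)
    (hR : IsNoetherianRing (R : Type _)ᵐᵒᵖ) : ∃ B, IsSyzygyList hA.toIsExtension G B := by
  classical
  choose S hS using fun m => leadingSyzygies_fg (G := G) hA hord hR m
  have hfin := finite_setOf_isLcm (G := G) hA.toIsExtension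
  have hmem : ∀ m, ∀ q ∈ S m, IsLeadingSyzygy hA.toIsExtension G m q := fun m q hq => by
    have : q ∈ leadingSyzygies hA hord G m := hS m ▸ Submodule.subset_span hq
    exact this
  refine ⟨(hfin.toFinset.biUnion S).toList, fun q hq => ?_, fun m hm q hq => ?_⟩
  · obtain ⟨m, hm, hq⟩ := Finset.mem_biUnion.1 (Finset.mem_toList.1 hq)
    exact ⟨m, hfin.mem_toFinset.1 hm, hmem m q hq⟩
  · have hq' : q ∈ leadingSyzygies hA hord G m := hq
    rw [← hS m] at hq'
    refine Submodule.span_mono (s := (S m : Set (Fin t → A))) (fun p hp => ?_) hq'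
    exact ⟨Finset.mem_toList.2 (Finset.mem_biUnion.2 ⟨m, hfin.mem_toFinset.2 hm, hp⟩),
      hmem m p hp⟩

end Syzygies

/-! ### Ideals of leading coefficients -/

lemma addColumn_col_castSucc {A : Type*} {r t : ℕ} (G : Matrix (Fin r) (Fin t) A)
    (v : Fin r → A) (j : Fin t) :
    (addColumn G v).col j.castSucc = G.col j := by
  funext i
  simp [addColumn, Matrix.col]

lemma addColumn_col_last {A : Type*} {r t : ℕ} (G : Matrix (Fin r) (Fin t) A)
    (v : Fin r → A) :
    (addColumn G v).col (Fin.last t) = v := by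
  funext i
  simp [addColumn, Matrix.col]

section LeadIdeal

variable {A : Type*} [Ring A] {R : Subring A} {n : ℕ} {x : Fin n → A} {r s t : ℕ}
  [LinearOrder (ModMon n r)] (hA : IsBijectiveExtension R x) {G : Matrix (Fin r) (Fin t) A}

/-- Multiplication by `b x^δ` multiplies the coefficient at the bound of a representation by an
element of `R` which can be prescribed. -/
lemma IsQuot.exists_translate (hord : IsMonomialOrder n r) {m : ModMon n r} {u : Fin t → A}
    (hu : IsQuot hA.toIsExtension G (Set.Iic m) u) (δ : Fin n → ℕ) (ρ : R) :
    ∃ v, IsQuot hA.toIsExtension G (Set.Iic (m.translate δ)) v ∧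
      coeff hA.toIsExtension (G *ᵥ v) (m.translate δ) =
        coeff hA.toIsExtension (G *ᵥ u) m * ρ := by
  obtain ⟨τ, c, h⟩ := hA.coeff_translate hord m δ
  have h1 := h (G *ᵥ u) (τ.symm (ρ * (c⁻¹ : Rˣ))) (hu.suppIn hA hord (isLowerSet_Iic m))
  refine ⟨_, hu.smul hA hord (isLowerSet_Iic (m.translate δ))
    (fun μ hμ => hord.translate_le hμ δ) (τ.symm (ρ * (c⁻¹ : Rˣ))), ?_⟩
  rw [Matrix.mulVec_smul, h1]
  simp

/-- The right ideal of `R` of the coefficients at `m` of the representations bounded by `m`, as an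
ideal of the opposite ring. -/
def leadIdeal (hord : IsMonomialOrder n r) (G : Matrix (Fin r) (Fin t) A) (m : ModMon n r) :
    Ideal (R : Type _)ᵐᵒᵖ where
  carrier := {y | ∃ u, IsQuot hA.toIsExtension G (Set.Iic m) u ∧
    coeff hA.toIsExtension (G *ᵥ u) m = y.unop}
  zero_mem' := ⟨0, IsQuot.zero, by simp⟩
  add_mem' := by
    rintro _ _ ⟨u, hu, e⟩ ⟨v, hv, e'⟩
    exact ⟨u + v, hu.add hv, by rw [Matrix.mulVec_add, coeff_add, e, e']; rfl⟩
  smul_mem' := by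
    rintro c _ ⟨u, hu, e⟩
    obtain ⟨v, hv, e'⟩ := hu.exists_translate hA hord 0 c.unop
    rw [ModMon.translate_zero] at hv e'
    exact ⟨v, hv, by rw [e', e]; rfl⟩

/-- No twist occurs here, because the effect of `x^δ` on a coefficient can be undone by a right
multiplication. -/
lemma leadIdeal_mono (hord : IsMonomialOrder n r) (m m' : ModMon n r) (h : m.Divides m') :
    leadIdeal hA hord G m ≤ leadIdeal hA hord G m' := by
  rintro _ ⟨u, hu, e⟩
  obtain ⟨v, hv, e'⟩ := hu.exists_translate hA hord (m'.exp - m.exp) 1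
  rw [h.translate_sub] at hv e'
  exact ⟨v, hv, by rw [e', e, mul_one]⟩

lemma addColumn_mulVec_snoc (G : Matrix (Fin r) (Fin t) A) (v : Fin r → A) (u : Fin t → A)
    (a : A) :
    addColumn G v *ᵥ (Fin.snoc u a : Fin (t + 1) → A) = G *ᵥ u + MulOpposite.op a • v := by
  funext i
  simp [addColumn, Matrix.mulVec, dotProduct, Fin.sum_univ_castSucc]

lemma leadIdeal_le_addColumn (hord : IsMonomialOrder n r) (v : Fin r → A) (m : ModMon n r) :
    leadIdeal hA hord G m ≤ leadIdeal hA hord (addColumn G v) m := by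
  rintro _ ⟨u, hu, e⟩
  refine ⟨Fin.snoc u 0, fun j => ?_, by rw [addColumn_mulVec_snoc, ← e]; simp⟩
  induction j using Fin.lastCases with
  | last => intro μ _ γ hγ; simp at hγ
  | cast j =>
    rw [addColumn_col_castSucc, Fin.snoc_castSucc]
    exact hu j

/-- Adjoining an irreducible vector enlarges the ideals of leading coefficients. -/
lemma leadIdeal_lt_addColumn (hord : IsMonomialOrder n r) {f : Fin r → A} (hf : f ≠ 0)
    (hirr : ¬ IsReducible hA.toIsExtension G f) :
    leadIdeal hA hord G < leadIdeal hA hord (addColumn G f) := by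
  obtain ⟨m, hm⟩ := exists_isLeadingMonomial (h := hA.toIsExtension) hf
  refine Pi.lt_def.2 ⟨fun μ => leadIdeal_le_addColumn hA hord f μ, m,
    (leadIdeal_le_addColumn hA hord f m).lt_of_not_ge fun hge => hirr ?_⟩
  have hmem : MulOpposite.op (coeff hA.toIsExtension f m) ∈
      leadIdeal hA hord (addColumn G f) m := by
    refine ⟨Fin.snoc 0 1, fun j => ?_, by rw [addColumn_mulVec_snoc]; simp⟩
    induction j using Fin.lastCases with
    | last =>
      intro μ hμ γ hγ
      rw [addColumn_col_last] at hμ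
      rw [Fin.snoc_last, ← mon_zero (x := x), hA.repr_mon] at hγ
      obtain rfl : (0 : Fin n → ℕ) = γ := by
        by_contra hne
        exact hγ (Finsupp.single_eq_of_ne (Ne.symm hne))
      rw [ModMon.translate_zero]
      exact (hμ.unique hm).le
    | cast j => intro μ _ γ hγ; simp at hγ
  -- a representation with the same coefficient at `m` as `f` contains a reduction of `f`
  obtain ⟨u, hu, e⟩ := hge hmem
  obtain ⟨q, hq, hlow⟩ := hu.exists_isTermVector hA hord
  refine ⟨q, m, hm, hq, ?_⟩
  have := (hlow.suppIn hA hord (isLowerSet_Iio m)).coeff_eq_zero (lt_irrefl m)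
  rw [Matrix.mulVec_sub, coeff_sub, sub_eq_zero] at this
  rw [← this, e, MulOpposite.unop_op]

end LeadIdeal

/-! ### Termination of reduction -/

section Reduction

variable {A : Type*} [Ring A] {R : Subring A} {n : ℕ} {x : Fin n → A} {r s t : ℕ}
  [LinearOrder (ModMon n r)] (hA : IsBijectiveExtension R x) {G : Matrix (Fin r) (Fin t) A}

lemma IsReduction.suppIn (hord : IsMonomialOrder n r) {f : Fin r → A} {q : Fin t → A}
    (hq : IsReduction hA.toIsExtension G f q) : ∃ m, IsLeadingMonomial hA.toIsExtension f m ∧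
      IsQuot hA.toIsExtension G (Set.Iic m) q ∧
      SuppIn hA.toIsExtension (Set.Iio m) (f - G *ᵥ q) := by
  obtain ⟨m, hm, hterm, hc⟩ := hq
  have h1 := hterm.isQuot hA hord
  refine ⟨m, hm, h1, SuppIn.Iio_of_coeff_eq_zero
    (hm.suppIn.sub (h1.suppIn hA hord (isLowerSet_Iic m))) ?_⟩
  rw [coeff_sub, hc, sub_self]

/-- Reduction modulo the columns of `G` terminates, because it lowers the leading monomial. -/
lemma wellFounded_reduction (hord : IsMonomialOrder n r) (G : Matrix (Fin r) (Fin t) A) :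
    WellFounded fun f' f => ∃ q, IsReduction hA.toIsExtension G f q ∧ f' = f - G *ᵥ q := by
  have := hord.wellFoundedLT
  have key : ∀ (m : ModMon n r) (f : Fin r → A), IsLeadingMonomial hA.toIsExtension f m →
      Acc (fun f' f => ∃ q, IsReduction hA.toIsExtension G f q ∧ f' = f - G *ᵥ q) f := by
    intro m
    induction m using WellFoundedLT.induction with
    | _ m ih =>
      refine fun f hf => ⟨_, ?_⟩
      rintro _ ⟨q, hq, rfl⟩
      obtain ⟨m', hm', -, hlt⟩ := hq.suppIn hA hord
      obtain rfl := hf.unique hm'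
      by_cases h0 : f - G *ᵥ q = 0
      · rw [h0]
        refine ⟨_, ?_⟩
        rintro _ ⟨_, ⟨_, hm, -⟩, -⟩
        exact absurd rfl hm.ne_zero
      · obtain ⟨m', hm'⟩ := exists_isLeadingMonomial (h := hA.toIsExtension) h0
        exact ih m' (hm'.mem_of_suppIn hlt) _ hm'
  refine ⟨fun f => ⟨_, ?_⟩⟩
  rintro f' ⟨q, hq, rfl⟩
  obtain ⟨m, hm, -⟩ := id hq
  exact (key m f hm).inv ⟨q, hq, rfl⟩

end Reduction

/-! ### Column modules and right inverses -/

section ColumnModule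

variable {A : Type*} [Ring A] {r s t : ℕ}

lemma mem_columnModule {F : Matrix (Fin r) (Fin s) A} {v : Fin r → A} :
    v ∈ columnModule F ↔ ∃ u, F *ᵥ u = v := by
  rw [columnModule, Submodule.mem_span_range_iff_exists_fun]
  constructor
  · rintro ⟨c, rfl⟩
    exact ⟨fun j => (c j).unop, by rw [Matrix.mulVec_eq_sum]; rfl⟩
  · rintro ⟨u, rfl⟩
    exact ⟨fun j => MulOpposite.op (u j), by rw [Matrix.mulVec_eq_sum]; rfl⟩

lemma mul_eq_one_iff_col {F : Matrix (Fin r) (Fin s) A} {L : Matrix (Fin s) (Fin r) A} :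
    F * L = 1 ↔ ∀ j, F *ᵥ L.col j = Pi.single j 1 := by
  have h1 : ∀ j, F *ᵥ L.col j = (F * L).col j := fun j => rfl
  have h2 : ∀ j : Fin r, (1 : Matrix (Fin r) (Fin r) A).col j = Pi.single j 1 := fun j => by
    funext i
    simp [Matrix.one_apply, Pi.single_apply]
  constructor
  · intro h j
    rw [h1, h, h2]
  · intro h
    ext i j
    exact congrFun ((h1 j).symm.trans ((h j).trans (h2 j).symm)) i

lemma exists_mul_eq_one_iff {F : Matrix (Fin r) (Fin s) A} :
    (∃ L : Matrix (Fin s) (Fin r) A, F * L = 1) ↔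
      ∀ j : Fin r, (Pi.single j 1 : Fin r → A) ∈ columnModule F := by
  simp only [mem_columnModule, mul_eq_one_iff_col]
  constructor
  · rintro ⟨L, hL⟩ j
    exact ⟨_, hL j⟩
  · intro h
    choose u hu using h
    exact ⟨Matrix.of fun i j => u j i, hu⟩

/-- By the rank condition a matrix with a right inverse has at least as many columns as rows. -/
lemma le_of_mul_eq_one [RankCondition A] {F : Matrix (Fin r) (Fin s) A}
    {L : Matrix (Fin s) (Fin r) A} (h : F * L = 1) : r ≤ s :=
  le_of_fin_surjective A L.vecMulLinear fun w => ⟨w ᵥ* F, by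
    simp [Matrix.vecMul_vecMul, h]⟩

end ColumnModule

/-! ### The division phase -/

section Division

variable {A : Type*} [Ring A] {R : Subring A} {n : ℕ} {x : Fin n → A} {r s t : ℕ}
  [LinearOrder (ModMon n r)] (hA : IsBijectiveExtension R x) {F : Matrix (Fin r) (Fin s) A}
  {G : Matrix (Fin r) (Fin t) A} {H : Matrix (Fin s) (Fin t) A}

/-- The invariant of the division of the canonical vectors by `G`: the columns of `K` found so far
express canonical vectors through `G`, and the output is correct. -/
def DivisionInvariant (F : Matrix (Fin r) (Fin s) A) (G : Matrix (Fin r) (Fin t) A)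
    (H : Matrix (Fin s) (Fin t) A) (c : State A r s) : Prop :=
  (∃ K j p, c = .test t G H K j p ∧ j ≤ r ∧
    ∀ i : Fin r, (i : ℕ) < j → G *ᵥ K.col i = Pi.single i 1) ∨
  (c = .done none ∧ ∃ j : Fin r, (Pi.single j 1 : Fin r → A) ∉ columnModule F) ∨
  ∃ K : Matrix (Fin t) (Fin r) A, c = .done (some (H * K)) ∧ G * K = 1

lemma IsRightGroebnerBasis.mulVec_mem {h : IsExtension R x}
    {N : Submodule Aᵐᵒᵖ (Fin r → A)} (hG : IsRightGroebnerBasis h N G) (u : Fin t → A) :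
    G *ᵥ u ∈ N := by
  rw [Matrix.mulVec_eq_sum]
  exact N.sum_mem fun j _ => N.smul_mem _ (hG.1 j)

lemma DivisionInvariant.step {h : IsExtension R x}
    (hG : IsRightGroebnerBasis h (columnModule F) G)
    {c c' : State A r s} (hc : DivisionInvariant F G H c) (hstep : Step h F c c') :
    DivisionInvariant F G H c' := by
  rcases hc with ⟨K, j, p, rfl, hj, hK⟩ | ⟨rfl, -⟩ | ⟨K, rfl, -⟩
  · cases hstep with
    | divide hlt hq => exact Or.inl ⟨K, j, _, rfl, hj, hK⟩
    | member hlt hp =>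
      refine Or.inl ⟨_, j + 1, _, rfl, hlt, fun i hi => ?_⟩
      by_cases hij : i = ⟨j, hlt⟩
      · subst hij
        have e : (K.updateCol ⟨j, hlt⟩ p).col ⟨j, hlt⟩ = p := by
          funext k
          simp [Matrix.col]
        rw [e]
        exact (sub_eq_zero.1 hp).symm
      · have e : (K.updateCol ⟨j, hlt⟩ p).col i = K.col i := by
          funext k
          simp [Matrix.col, hij]
        have : (i : ℕ) ≠ j := fun e => hij (Fin.ext e)
        rw [e]
        exact hK i (by omega)
    | notMember hlt hne hirr =>
      refine Or.inr (Or.inl ⟨rfl, ⟨j, hlt⟩, fun hmem => hirr (hG.2 _ ?_ hne)⟩)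
      exact Submodule.sub_mem _ hmem (hG.mulVec_mem p)
    | output => exact Or.inr (Or.inr ⟨K, rfl, mul_eq_one_iff_col.2 fun i => hK i i.2⟩)
  · cases hstep
  · cases hstep

/-- The division phase terminates for every matrix `G`: for each canonical vector reduction stops,
and `r - j` decreases when the next one is taken. -/
lemma acc_test (hord : IsMonomialOrder n r) (F : Matrix (Fin r) (Fin s) A)
    (G : Matrix (Fin r) (Fin t) A) (H : Matrix (Fin s) (Fin t) A)
    (K : Matrix (Fin t) (Fin r) A) (j : ℕ) (p : Fin t → A) :
    Acc (fun b a => Step hA.toIsExtension F a b) (.test t G H K j p) := by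
  have hdone : ∀ out, Acc (fun b a => Step hA.toIsExtension F a b) (.done out) :=
    fun out => ⟨_, fun c hc => by cases hc⟩
  induction hk : r - j generalizing j K p with
  | zero =>
    refine ⟨_, fun c hc => ?_⟩
    cases hc with
    | output => exact hdone _
    | divide hj => omega
    | member hj => omega
    | notMember hj => omega
  | succ k ih =>
    have hj : j < r := by omega
    generalize hf : (Pi.single (⟨j, hj⟩ : Fin r) 1 - G *ᵥ p : Fin r → A) = f
    induction f using (wellFounded_reduction hA hord G).induction generalizing p with
    | _ f ihf =>
      refine ⟨_, fun c hc => ?_⟩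
      cases hc with
      | output => exact hdone _
      | @divide _ _ _ _ _ _ q hj' hq =>
        rw [hf] at hq
        refine ihf _ ⟨q, hq, rfl⟩ _ ?_
        rw [Matrix.mulVec_add, ← sub_sub, hf]
      | member hj' => exact ih _ _ _ (by omega)
      | notMember => exact hdone _

lemma DivisionInvariant.exists_step {h : IsExtension R x} {c : State A r s}
    (hc : DivisionInvariant F G H c) : (∃ c', Step h F c c') ∨ ∃ out, c = .done out := by
  rcases hc with ⟨K, j, p, rfl, hj, -⟩ | ⟨rfl, -⟩ | ⟨K, rfl, -⟩
  · left
    rcases hj.lt_or_eq with hj | rfl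
    · by_cases h0 : (Pi.single (⟨j, hj⟩ : Fin r) 1 - G *ᵥ p : Fin r → A) = 0
      · exact ⟨_, .member hj h0⟩
      · by_cases hred : IsReducible h G (Pi.single (⟨j, hj⟩ : Fin r) 1 - G *ᵥ p)
        · obtain ⟨q, hq⟩ := hred
          exact ⟨_, .divide hj hq⟩
        · exact ⟨_, .notMember hj h0 hred⟩
    · exact ⟨_, .output⟩
  · exact Or.inr ⟨_, rfl⟩
  · exact Or.inr ⟨_, rfl⟩

end Division

/-! ### Buchberger's algorithm -/

section Buchberger

variable {A : Type*} [Ring A] {R : Subring A} {n : ℕ} {x : Fin n → A} {r s t : ℕ}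
  [LinearOrder (ModMon n r)] (hA : IsBijectiveExtension R x) {F : Matrix (Fin r) (Fin s) A}
  {G : Matrix (Fin r) (Fin t) A} {H : Matrix (Fin s) (Fin t) A}

/-- `G = F H` and the columns of `F` are combinations of the columns of `G`. -/
def SameColumns (F : Matrix (Fin r) (Fin s) A) (G : Matrix (Fin r) (Fin t) A)
    (H : Matrix (Fin s) (Fin t) A) : Prop :=
  G = F * H ∧ ∀ u, ∃ v, G *ᵥ v = F *ᵥ u

/-- If `q` is a syzygy of leading terms at `m`, then its S-vector has a representation below `m`. -/
def HasLowRepresentation (h : IsExtension R x) (G : Matrix (Fin r) (Fin t) A)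
    (q : Fin t → A) : Prop :=
  ∀ m, IsLeadingSyzygy h G m q → ∃ u, IsQuot h G (Set.Iio m) u ∧ G *ᵥ u = G *ᵥ q

/-- The invariant of the whole algorithm. While the S-vector of `q` is being reduced, with remainder
`G p`, the part `G (q - p)` subtracted so far is a representation below every monomial `m` at which
`q` is a syzygy. -/
def Invariant (h : IsExtension R x) (F : Matrix (Fin r) (Fin s) A) : State A r s → Prop
  | .start => True
  | .basis _ G H => SameColumns F G H
  | .pending _ G H todo => SameColumns F G H ∧ ∃ B, IsSyzygyList h G B ∧
      ∀ q ∈ B, q ∈ todo ∨ HasLowRepresentation h G q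
  | .reducing _ G H todo p => SameColumns F G H ∧ ∃ B q₀, IsSyzygyList h G B ∧
      (∀ q ∈ B, q = q₀ ∨ q ∈ todo ∨ HasLowRepresentation h G q) ∧
      ∀ m, IsLeadingSyzygy h G m q₀ → SuppIn h (Set.Iio m) (G *ᵥ p) ∧
        IsQuot h G (Set.Iio m) (q₀ - p)
  | .test t G H K j p => IsRightGroebnerBasis h (columnModule F) G ∧ G = F * H ∧
      DivisionInvariant F G H (.test t G H K j p)
  | .done out => (out = none ∧ s < r) ∨ ∃ (t : ℕ) (G : Matrix (Fin r) (Fin t) A)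
      (H : Matrix (Fin s) (Fin t) A), IsRightGroebnerBasis h (columnModule F) G ∧ G = F * H ∧
      DivisionInvariant F G H (.done out)

lemma DivisionInvariant.invariant {h : IsExtension R x}
    (hG : IsRightGroebnerBasis h (columnModule F) G) (hGH : G = F * H) {c : State A r s}
    (hc : DivisionInvariant F G H c) : Invariant h F c := by
  rcases id hc with ⟨K, j, p, rfl, -⟩ | ⟨rfl, -⟩ | ⟨K, rfl, -⟩
  · exact ⟨hG, hGH, hc⟩
  · exact Or.inr ⟨t, G, H, hG, hGH, hc⟩
  · exact Or.inr ⟨t, G, H, hG, hGH, hc⟩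

lemma SameColumns.addColumn (h : SameColumns F G H) (p : Fin t → A) :
    SameColumns F (addColumn G (G *ᵥ p)) (addColumn H (H *ᵥ p)) := by
  refine ⟨?_, fun u => ?_⟩
  · ext i j
    have hcol : (SkewPBW.addColumn G (G *ᵥ p)).col j =
        F *ᵥ (SkewPBW.addColumn H (H *ᵥ p)).col j := by
      induction j using Fin.lastCases with
      | last => rw [addColumn_col_last, addColumn_col_last, Matrix.mulVec_mulVec, ← h.1]
      | cast j => rw [addColumn_col_castSucc, addColumn_col_castSucc, h.1]; rfl
    exact congrFun hcol i
  · obtain ⟨v, hv⟩ := h.2 u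
    exact ⟨Fin.snoc v 0, by rw [addColumn_mulVec_snoc, hv]; simp⟩

lemma Invariant.step (hord : IsMonomialOrder n r) {c c' : State A r s}
    (hc : Invariant hA.toIsExtension F c) (hstep : Step hA.toIsExtension F c c') :
    Invariant hA.toIsExtension F c' := by
  cases hstep with
  | small hlt => exact Or.inl ⟨rfl, hlt⟩
  | init hle => exact ⟨(Matrix.mul_one F).symm, fun u => ⟨u, rfl⟩⟩
  | syzygies hB => exact ⟨hc, _, hB, fun q hq => Or.inl hq⟩
  | @next t G H q todo =>
    obtain ⟨hF, B, hB, hq⟩ := hc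
    refine ⟨hF, B, q, hB, fun q' hq' => ?_, fun m hm => ⟨?_, ?_⟩⟩
    · rcases hq q' hq' with hmem | hlow
      · exact (List.mem_cons.1 hmem).imp_right Or.inl
      · exact Or.inr (Or.inr hlow)
    · exact ((hm.1.isQuot hA hord).suppIn hA hord (isLowerSet_Iic m)).Iio_of_coeff_eq_zero hm.2
    · rw [sub_self]
      exact IsQuot.zero
  | @reduce t G H todo p q hq =>
    obtain ⟨hF, B, q₀, hB, htodo, hlow⟩ := hc
    refine ⟨hF, B, q₀, hB, htodo, fun m hm => ?_⟩
    obtain ⟨hsupp, hquot⟩ := hlow m hm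
    obtain ⟨μ, hμ, hqμ, hrest⟩ := hq.suppIn hA hord
    have hlt : μ < m := hμ.mem_of_suppIn hsupp
    rw [Matrix.mulVec_sub, ← sub_add]
    exact ⟨hrest.mono (Set.Iio_subset_Iio hlt.le),
      hquot.add (hqμ.mono fun _ h => lt_of_le_of_lt h hlt)⟩
  | discard hp =>
    obtain ⟨hF, B, q₀, hB, htodo, hlow⟩ := hc
    refine ⟨hF, B, hB, fun q hq => ?_⟩
    rcases htodo q hq with rfl | h
    · exact Or.inr fun m hm => ⟨_, (hlow m hm).2, by rw [Matrix.mulVec_sub, hp, sub_zero]⟩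
    · exact h
  | enlarge hne hirr => exact hc.1.addColumn _
  | @finish t G H =>
    obtain ⟨⟨hGH, hF⟩, B, hB, hlow⟩ := hc
    have hG : IsRightGroebnerBasis hA.toIsExtension (columnModule F) G := by
      refine ⟨fun j => mem_columnModule.2 ⟨H.col j, by rw [hGH]; rfl⟩, fun f hf hne => ?_⟩
      obtain ⟨u, rfl⟩ := mem_columnModule.1 hf
      obtain ⟨v, hv⟩ := hF u
      rw [← hv] at hne ⊢
      exact isReducible_of_isSyzygyList hA hord hB
        (fun q hq => (hlow q hq).resolve_left (List.not_mem_nil)) hne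
    exact ⟨hG, hGH, Or.inl ⟨_, _, _, rfl, Nat.zero_le r, fun i hi => absurd hi (Nat.not_lt_zero _)⟩⟩
  | divide hj hq =>
    exact (hc.2.2.step hc.1 (.divide hj hq)).invariant hc.1 hc.2.1
  | member hj hp => exact (hc.2.2.step hc.1 (.member hj hp)).invariant hc.1 hc.2.1
  | notMember hj hp hirr =>
    exact (hc.2.2.step hc.1 (.notMember hj hp hirr)).invariant hc.1 hc.2.1
  | output => exact (hc.2.2.step hc.1 .output).invariant hc.1 hc.2.1

/-- The algorithm never gets stuck; the Noetherian hypothesis provides the generators of the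
syzygies. -/
lemma Invariant.exists_step (hord : IsMonomialOrder n r)
    (hR : IsNoetherianRing (R : Type _)ᵐᵒᵖ) {c : State A r s}
    (hc : Invariant hA.toIsExtension F c) :
    (∃ c', Step hA.toIsExtension F c c') ∨ ∃ out, c = .done out := by
  cases c with
  | start =>
    rcases lt_or_ge s r with hlt | hle
    · exact Or.inl ⟨_, .small hlt⟩
    · exact Or.inl ⟨_, .init hle⟩
  | basis t G H =>
    obtain ⟨B, hB⟩ := exists_isSyzygyList (G := G) hA hord hR
    exact Or.inl ⟨_, .syzygies hB⟩
  | pending t G H todo =>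
    cases todo with
    | nil => exact Or.inl ⟨_, .finish⟩
    | cons q todo => exact Or.inl ⟨_, .next⟩
  | reducing t G H todo p =>
    by_cases h0 : G *ᵥ p = 0
    · exact Or.inl ⟨_, .discard h0⟩
    · by_cases hred : IsReducible hA.toIsExtension G (G *ᵥ p)
      · obtain ⟨q, hq⟩ := hred
        exact Or.inl ⟨_, .reduce hq⟩
      · exact Or.inl ⟨_, .enlarge h0 hred⟩
  | test t G H K j p => exact hc.2.2.exists_step
  | done out => exact Or.inr ⟨out, rfl⟩

/-- Buchberger's algorithm terminates: every new generator enlarges the monotone family of ideals of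
leading coefficients, and for a fixed `G` the finitely many S-vectors are reduced in finitely many
steps. -/
lemma acc_basis (hord : IsMonomialOrder n r) (hR : IsNoetherianRing (R : Type _)ᵐᵒᵖ)
    (F : Matrix (Fin r) (Fin s) A) (t : ℕ) (G : Matrix (Fin r) (Fin t) A)
    (H : Matrix (Fin s) (Fin t) A) :
    Acc (fun b a => Step hA.toIsExtension F a b) (.basis t G H) := by
  have : WellFoundedGT (Ideal (R : Type _)ᵐᵒᵖ) := wellFoundedGT
  have hwf := wellFounded_gt_monotone_of_wellQuasiOrdered (I := Ideal (R : Type _)ᵐᵒᵖ)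
    (ModMon.wellQuasiOrdered_divides (n := n) (r := r))
  generalize hφ : (⟨leadIdeal hA hord G, leadIdeal_mono hA hord⟩ :
    {f : ModMon n r → Ideal (R : Type _)ᵐᵒᵖ // ∀ a b, a.Divides b → f a ≤ f b}) = φ
  induction φ using hwf.induction generalizing t G H with
  | _ φ ih =>
    have hpend : ∀ todo, Acc (fun b a => Step hA.toIsExtension F a b) (.pending t G H todo) := by
      intro todo
      induction todo with
      | nil =>
        refine ⟨_, fun c hc => ?_⟩
        cases hc with
        | finish => exact acc_test hA hord F G H 0 0 0
      | cons q todo ihtodo =>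
        refine ⟨_, fun c hc => ?_⟩
        cases hc with
        | next =>
          generalize hf : G *ᵥ q = f
          induction f using (wellFounded_reduction hA hord G).induction generalizing q with
          | _ f ihf =>
            refine ⟨_, fun c hc => ?_⟩
            cases hc with
            | @reduce _ _ _ _ _ q' hq =>
              rw [hf] at hq
              exact ihf _ ⟨q', hq, rfl⟩ _ (by rw [Matrix.mulVec_sub, hf])
            | discard => exact ihtodo
            | enlarge hne hirr =>
              refine ih _ ?_ _ _ _ rfl
              rw [← hφ]
              exact leadIdeal_lt_addColumn hA hord hne hirr
    refine ⟨_, fun c hc => ?_⟩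
    cases hc with
    | syzygies hB => exact hpend _

end Buchberger
end SkewPBW

open SkewPBW in
theorem mainTheorem2 {A : Type*} [Ring A] [RankCondition A] (R : Subring A) {n : ℕ}
    (x : Fin n → A) (hA : IsBijectiveExtension R x) {r s : ℕ} [LinearOrder (ModMon n r)]
    (hord : IsMonomialOrder n r) (F : Matrix (Fin r) (Fin s) A) :
    -- whatever is returned is right
    (∀ out, Reaches hA.toIsExtension F .start (.done out) →
      (out = none ↔ ¬ ∃ L : Matrix (Fin s) (Fin r) A, F * L = 1) ∧
      (out = none ↔ s < r ∨ ∃ j : Fin r, Pi.single j 1 ∉ columnModule F) ∧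
      ∀ L, out = some L → F * L = 1 ∧
        ∃ (t : ℕ) (G : Matrix (Fin r) (Fin t) A) (H : Matrix (Fin s) (Fin t) A)
          (K : Matrix (Fin t) (Fin r) A),
          IsRightGroebnerBasis hA.toIsExtension (columnModule F) G ∧
          G = F * H ∧ G * K = 1 ∧ L = H * K) ∧
    -- if the coefficient ring is right Noetherian, the algorithm always stops
    (IsNoetherianRing (R : Type _)ᵐᵒᵖ → AlwaysHalts hA.toIsExtension F .start) ∧
    -- the canonical vectors are divided by a right Gröbner basis `G = F H`
    (∀ t G H K j p, Reaches hA.toIsExtension F .start (.test t G H K j p) →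
      IsRightGroebnerBasis hA.toIsExtension (columnModule F) G ∧ G = F * H) ∧
    -- any other right Gröbner basis `G = F H` may be used in its place
    (r ≤ s → ∀ (t : ℕ) (G : Matrix (Fin r) (Fin t) A) (H : Matrix (Fin s) (Fin t) A),
      IsRightGroebnerBasis hA.toIsExtension (columnModule F) G → G = F * H →
      AlwaysHalts hA.toIsExtension F (.test t G H 0 0 0) ∧
      ∀ out, Reaches hA.toIsExtension F (.test t G H 0 0 0) (.done out) →
        (out = none ↔ ¬ ∃ L : Matrix (Fin s) (Fin r) A, F * L = 1) ∧
        (out = none ↔ ∃ j : Fin r, Pi.single j 1 ∉ columnModule F) ∧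
        ∀ L, out = some L → F * L = 1 ∧
          ∃ K : Matrix (Fin t) (Fin r) A, G * K = 1 ∧ L = H * K) := by
  have hinv : ∀ c, Reaches hA.toIsExtension F .start c → Invariant hA.toIsExtension F c := by
    intro c hc
    induction hc with
    | refl => exact trivial
    | tail _ hstep ih => exact ih.step hA hord hstep
  have hL : ∀ {t : ℕ} {G : Matrix (Fin r) (Fin t) A} {H : Matrix (Fin s) (Fin t) A}
      {K : Matrix (Fin t) (Fin r) A}, G = F * H → G * K = 1 → F * (H * K) = 1 := by
    intro t G H K hGH hK
    rw [← Matrix.mul_assoc, ← hGH, hK]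
  have hnot : (¬ ∃ L : Matrix (Fin s) (Fin r) A, F * L = 1) ↔
      ∃ j : Fin r, Pi.single j 1 ∉ columnModule F := by
    rw [exists_mul_eq_one_iff, not_forall]
  refine ⟨fun out hout => ?_, fun hR => ⟨⟨_, fun c hc => ?_⟩, fun c hc =>
    (hinv c hc).exists_step hA hord hR⟩, fun t G H K j p hreach => ?_,
    fun hrs t G H hG hGH => ?_⟩
  · rcases hinv _ hout with ⟨rfl, hlt⟩ | ⟨t, G, H, hG, hGH, ⟨_, _, _, e, -⟩ | ⟨e, hj⟩ | ⟨K, e, hK⟩⟩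
    · have : ¬ ∃ L : Matrix (Fin s) (Fin r) A, F * L = 1 :=
        fun ⟨L, hL⟩ => (le_of_mul_eq_one hL).not_gt hlt
      simp [this, hlt]
    · cases e
    · cases e
      simp [hnot, hj]
    · cases e
      have hright := hL hGH hK
      have hex : ∃ L : Matrix (Fin s) (Fin r) A, F * L = 1 := ⟨_, hright⟩
      refine ⟨by simp [hex], ?_, ?_⟩
      · rw [← hnot]
        simp [hex, le_of_mul_eq_one hright]
      · rintro L ⟨⟩
        exact ⟨hright, t, G, H, K, hG, hGH, hK, rfl⟩
  · cases hc with
    | small => exact ⟨_, fun c hc => by cases hc⟩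
    | init => exact acc_basis hA hord hR F _ _ _
  · exact ⟨(hinv _ hreach).1, (hinv _ hreach).2.1⟩
  · have hdiv : ∀ c, Reaches hA.toIsExtension F (.test t G H 0 0 0) c →
        DivisionInvariant F G H c := by
      intro c hc
      induction hc with
      | refl =>
        exact Or.inl ⟨_, _, _, rfl, Nat.zero_le r, fun i hi => absurd hi (Nat.not_lt_zero _)⟩
      | tail _ hstep ih => exact ih.step hG hstep
    refine ⟨⟨acc_test hA hord F G H 0 0 0, fun c hc => (hdiv c hc).exists_step⟩, fun out hout => ?_⟩
    rw [hnot]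
    rcases hdiv _ hout with ⟨_, _, _, e, -⟩ | ⟨e, hj⟩ | ⟨K, e, hK⟩
    · cases e
    · cases e
      simp [hj]
    · cases e
      have hright := hL hGH hK
      have hex : ∃ L : Matrix (Fin s) (Fin r) A, F * L = 1 := ⟨_, hright⟩
      rw [← hnot]
      refine ⟨by simp [hex], by simp [hex], ?_⟩
      rintro L ⟨⟩
      exact ⟨hright, K, hK, rfl⟩
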